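/- Let $\mathcal H$ be the upper half plane, $q=e^{2\pi i\tau}$, $D_\tau=\frac1{2\pi i}\frac{\partial}{\partial\tau}$, $D_z=\frac1{2\pi i}\frac{\partial}{\partial z}$, $\Lambda_\tau=\mathbb Z+\tau\mathbb Z$, and $E_2(\tau)=1-24\sum_{n\ge1}\sigma_1(n)q^n$. For $k\in\mathbb Z$ and $p\in\mathbb Z_{\ge0}$, a weak Jacobi form of weight $k$ and index $p$ is a holomorphic function $f\colon\mathcal H\times\mathbb C\to\mathbb C$ such that $$(c\tau+d)^{-k}e^{-2\pi i p\frac{cz^2}{c\tau+d}}f\Bigl(\tfrac{a\tau+b}{c\tau+d},\tfrac{z}{c\tau+d}\Bigr)=f(\tau,z),\qquad e^{2\pi i p(\lambda^2\tau+2\lambda z)}f(\tau,z+\lambda\tau+\mu)=f(\tau,z)$$ for all $\begin{pmatrix}a&b\\c&d\end{pmatrix}\in\mathrm{SL}(2,\mathbb Z)$ and $\lambda,\mu\in\mathbb Z$, and which has a Fourier expansion $f(\tau,z)=\sum_{n\ge0}\sum_{r\in\mathbb Z,\ r^2\le 4np+p^2}c(n,r)e^{2\pi i(n\tau+rz)}$.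 Let $\widetilde J_{k,p}$ be the complex vector space of these functions and let $\widetilde J_{\mathrm{ev},*}=\bigoplus_{k\in2\mathbb Z,\,p\ge0}\widetilde J_{k,p}$, a bigraded algebra. Let $$\zeta(\tau,z)=\frac1z+\sum_{\omega\in\Lambda_\tau\setminus\{0\}}\Bigl(\frac1{z-\omega}+\frac1\omega+\frac z{\omega^2}\Bigr)$$ be the Weierstrass zeta function, and for $z\notin\Lambda_\tau$ put $$J_1(\tau,z)=\frac1{2\pi i}\zeta(\tau,z)+\frac{\pi i}{6}zE_2(\tau),\qquad J_2=D_zJ_1-\frac1{12}E_2+J_1^2 .$$ For $k$ even and $f\in\widetilde J_{k,p}$ let $$\mathrm{Ob}(f)=D_\tau f-\frac k{12}E_2f-J_1D_zf+pJ_2f\qquad(z\notin\Lambda_\tau),$$ extended to the points $z\in\Lambda_\tau$ by taking the limit in $z$. Then the following hold. 1. For all $k\in2\mathbb Z$ and $p\in\mathbb Z_{\ge0}$, $\mathrm{Ob}$ is a linear map from $\widetilde J_{k,p}$ to $\widetilde J_{k+2,p}$. In particular the limits exist and $\mathrm{Ob}(f)$ is holomorphic on $\mathcal H\times\mathbb C$.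 2. For all $k,\ell\in2\mathbb Z$, $p,q\in\mathbb Z_{\ge0}$, $f\in\widetilde J_{k,p}$ and $g\in\widetilde J_{\ell,q}$, one has $\mathrm{Ob}(fg)=\mathrm{Ob}(f)\,g+f\,\mathrm{Ob}(g)$. 3. There is a unique $\mathbb C$-derivation of $\widetilde J_{\mathrm{ev},*}$ that is given by $\mathrm{Ob}$ on every homogeneous component $\widetilde J_{k,p}$. It extends the Serre derivative: if $k$ is even and $f$ is a modular form of weight $k$ on $\mathrm{SL}(2,\mathbb Z)$, then $f$, as a function of $(\tau,z)$ independent of $z$, lies in $\widetilde J_{k,0}$, and the derivation sends it to $D_\tau f-\frac k{12}E_2f$, which is a modular form of weight $k+2$. -/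

import Mathlib

open UpperHalfPlane hiding I
open Complex Filter
open scoped Real Topology MatrixGroups DirectSum

namespace WeakJacobi

noncomputable section

/-! ### Weak Jacobi forms on `SL(2, ℤ)` -/

/-- Holomorphic functions of two variables on `ℍ × ℂ`. -/
def IsHolo (f : ℍ × ℂ → ℂ) : Prop :=
  DifferentiableOn ℂ (fun x : ℂ × ℂ => f (ofComplex x.1, x.2)) {x | 0 < x.1.im}

/-- The action of `SL(2, ℤ)` in weight `k` and index `m`. -/
def slashSL (k : ℤ) (m : ℕ) (γ : SL(2, ℤ)) (f : ℍ × ℂ → ℂ) : ℍ × ℂ → ℂ := fun x =>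
  (denom γ x.1) ^ (-k) * cexp (-(2 * π * I * (m * (γ 1 0 : ℂ) * x.2 ^ 2 / denom γ x.1))) *
    f (γ • x.1, x.2 / denom γ x.1)

/-- The action of `ℤ²` in index `m`. -/
def slashZ (m : ℕ) (a b : ℤ) (f : ℍ × ℂ → ℂ) : ℍ × ℂ → ℂ := fun x =>
  cexp (2 * π * I * (m * ((a : ℂ) ^ 2 * x.1 + 2 * a * x.2))) * f (x.1, x.2 + a * x.1 + b)

/-- The function `(τ, z) ↦ exp (2πi (n τ + r z))`, where `N = (n, r)`. -/
def fourierMode (N : ℕ × ℤ) (x : ℍ × ℂ) : ℂ :=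
  cexp (2 * π * I * ((N.1 : ℂ) * x.1 + (N.2 : ℂ) * x.2))

/-- `f = ∑_{n ≥ 0} ∑_{r² ≤ 4nm + m²} c(n, r) exp (2πi (n τ + r z))` on all of `ℍ × ℂ`. -/
def HasWeakFourierExpansion (m : ℕ) (f : ℍ × ℂ → ℂ) : Prop :=
  ∃ c : ℕ × ℤ → ℂ,
    (∀ N : ℕ × ℤ, c N ≠ 0 → N.2 ^ 2 ≤ 4 * (N.1 : ℤ) * m + (m : ℤ) ^ 2) ∧
    ∀ x : ℍ × ℂ, HasSum (fun N => c N * fourierMode N x) (f x)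

/-- The space of weak Jacobi forms of weight `k` and index `m`. -/
def weakJacobiForms (k : ℤ) (m : ℕ) : Submodule ℂ (ℍ × ℂ → ℂ) where
  carrier := {f | IsHolo f ∧ (∀ γ, slashSL k m γ f = f) ∧ (∀ a b, slashZ m a b f = f) ∧
    HasWeakFourierExpansion m f}
  zero_mem' := by
    refine ⟨differentiableOn_const 0, fun γ => ?_, fun a b => ?_, 0, by simp, fun x => ?_⟩
    · ext x; simp [slashSL]
    · ext x; simp [slashZ]
    · simp [hasSum_zero]
  add_mem' := by
    rintro f g ⟨hf, hf1, hf2, c, hc, hfc⟩ ⟨hg, hg1, hg2, d, hd, hgd⟩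
    refine ⟨hf.add hg, fun γ => ?_, fun a b => ?_, c + d, fun N hN => ?_, fun x => ?_⟩
    · ext x
      have h1 := congrFun (hf1 γ) x
      have h2 := congrFun (hg1 γ) x
      simp only [slashSL, Pi.add_apply] at h1 h2 ⊢
      rw [mul_add, h1, h2]
    · ext x
      have h1 := congrFun (hf2 a b) x
      have h2 := congrFun (hg2 a b) x
      simp only [slashZ, Pi.add_apply] at h1 h2 ⊢
      rw [mul_add, h1, h2]
    · by_cases h : c N = 0
      · exact hd N fun h' => hN (by simp [h, h'])
      · exact hc N h
    · simpa [add_mul] using (hfc x).add (hgd x)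
  smul_mem' := by
    rintro s f ⟨hf, hf1, hf2, c, hc, hfc⟩
    refine ⟨hf.const_smul s, fun γ => ?_, fun a b => ?_, s • c, fun N hN => ?_, fun x => ?_⟩
    · ext x
      have h1 := congrFun (hf1 γ) x
      simp only [slashSL, Pi.smul_apply, smul_eq_mul] at h1 ⊢
      rw [mul_left_comm, h1]
    · ext x
      have h1 := congrFun (hf2 a b) x
      simp only [slashZ, Pi.smul_apply, smul_eq_mul] at h1 ⊢
      rw [mul_left_comm, h1]
    · exact hc N fun h => hN (by simp [h])
    · simpa [mul_assoc] using (hfc x).mul_left s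

/-! ### The bigraded algebra of weak Jacobi forms of even weight -/

/-- The homogeneous components of the bigraded algebra; `(j, m)` stands for weight `2 j` and
index `m`. -/
abbrev evComponent (i : ℤ × ℕ) : Submodule ℂ (ℍ × ℂ → ℂ) := weakJacobiForms (2 * i.1) i.2

lemma fourierMode_add (M N : ℕ × ℤ) (x : ℍ × ℂ) :
    fourierMode (M + N) x = fourierMode M x * fourierMode N x := by
  simp only [fourierMode, ← Complex.exp_add]
  congr 1
  push_cast [Prod.fst_add, Prod.snd_add]
  ring

lemma support_add {m₁ m₂ n₁ n₂ : ℕ} {r₁ r₂ : ℤ}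
    (h₁ : r₁ ^ 2 ≤ 4 * (n₁ : ℤ) * m₁ + (m₁ : ℤ) ^ 2)
    (h₂ : r₂ ^ 2 ≤ 4 * (n₂ : ℤ) * m₂ + (m₂ : ℤ) ^ 2) :
    (r₁ + r₂) ^ 2 ≤ 4 * ((n₁ + n₂ : ℕ) : ℤ) * (m₁ + m₂ : ℕ) + ((m₁ + m₂ : ℕ) : ℤ) ^ 2 := by
  push_cast
  have hm₁ : (0 : ℤ) ≤ m₁ := by positivity
  have hm₂ : (0 : ℤ) ≤ m₂ := by positivity
  have hn₁ : (0 : ℤ) ≤ n₁ := by positivity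
  have hn₂ : (0 : ℤ) ≤ n₂ := by positivity
  generalize (m₁ : ℤ) = a at *
  generalize (m₂ : ℤ) = b at *
  generalize (n₁ : ℤ) = u at *
  generalize (n₂ : ℤ) = v at *
  rcases hm₁.eq_or_lt with rfl | ha
  · have : r₁ = 0 := by nlinarith
    subst this
    nlinarith [mul_nonneg hn₁ hm₂]
  rcases hm₂.eq_or_lt with rfl | hb
  · have : r₂ = 0 := by nlinarith
    subst this
    nlinarith [mul_nonneg hn₂ hm₁]
  have key : a * b * (r₁ + r₂) ^ 2 ≤ a * b * (4 * (u + v) * (a + b) + (a + b) ^ 2) := by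
    have e₁ := mul_le_mul_of_nonneg_left h₁ (mul_nonneg hm₂ (add_nonneg hm₁ hm₂))
    have e₂ := mul_le_mul_of_nonneg_left h₂ (mul_nonneg hm₁ (add_nonneg hm₁ hm₂))
    nlinarith [sq_nonneg (b * r₁ - a * r₂)]
  exact le_of_mul_le_mul_left key (mul_pos ha hb)

lemma HasWeakFourierExpansion.mul {m₁ m₂ : ℕ} {f g : ℍ × ℂ → ℂ}
    (hf : HasWeakFourierExpansion m₁ f) (hg : HasWeakFourierExpansion m₂ g) :
    HasWeakFourierExpansion (m₁ + m₂) (f * g) := by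
  obtain ⟨c, hc, hfc⟩ := hf
  obtain ⟨d, hd, hgd⟩ := hg
  let s : (ℕ × ℤ) × (ℕ × ℤ) → ℕ × ℤ := fun y => y.1 + y.2
  refine ⟨fun N => ∑' y : {y // s y = N}, c y.1.1 * d y.1.2, fun N hN => ?_, fun x => ?_⟩
  · by_contra hlt
    refine hN ?_
    rw [← tsum_zero (α := ℂ) (β := {y // s y = N})]
    refine tsum_congr fun ⟨y, hy⟩ => ?_
    by_contra h
    obtain ⟨h1, h2⟩ := mul_ne_zero_iff.mp h
    refine hlt ?_
    rw [← hy]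
    exact support_add (hc _ h1) (hd _ h2)
  · have h0 : Summable fun y : (ℕ × ℤ) × (ℕ × ℤ) =>
        (c y.1 * fourierMode y.1 x) * (d y.2 * fourierMode y.2 x) :=
      summable_mul_of_summable_norm (f := fun N => c N * fourierMode N x)
        (g := fun N => d N * fourierMode N x) (hfc x).summable.norm (hgd x).summable.norm
    have h1 := (hfc x).mul (hgd x) h0
    rw [← (Equiv.sigmaFiberEquiv s).hasSum_iff] at h1
    refine h1.sigma fun N => ?_
    have h2 := (h1.summable.sigma_factor N).hasSum
    convert! h2 using 1
    rw [← tsum_mul_right]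
    refine tsum_congr fun ⟨y, hy⟩ => ?_
    simp only [Function.comp, Equiv.sigmaFiberEquiv_apply]
    rw [← hy, fourierMode_add]
    ring

lemma mul_mem_weakJacobiForms {k l : ℤ} {p q : ℕ} {f g : ℍ × ℂ → ℂ}
    (hf : f ∈ weakJacobiForms k p) (hg : g ∈ weakJacobiForms l q) :
    f * g ∈ weakJacobiForms (k + l) (p + q) := by
  obtain ⟨hf, hf1, hf2, hf3⟩ := hf
  obtain ⟨hg, hg1, hg2, hg3⟩ := hg
  refine ⟨hf.mul hg, fun γ => ?_, fun a b => ?_, hf3.mul hg3⟩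
  · ext x
    rw [Pi.mul_apply, ← congrFun (hf1 γ) x, ← congrFun (hg1 γ) x]
    have h0 : denom γ x.1 ≠ 0 := denom_ne_zero γ x.1
    simp only [slashSL, Pi.mul_apply]
    rw [neg_add, zpow_add₀ h0]
    have : cexp (-(2 * π * I * (((p + q : ℕ) : ℂ) * (γ 1 0 : ℂ) * x.2 ^ 2 / denom γ x.1))) =
        cexp (-(2 * π * I * (p * (γ 1 0 : ℂ) * x.2 ^ 2 / denom γ x.1))) *
        cexp (-(2 * π * I * (q * (γ 1 0 : ℂ) * x.2 ^ 2 / denom γ x.1))) := by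
      rw [← Complex.exp_add]
      congr 1
      push_cast
      ring
    rw [this]
    ring
  · ext x
    rw [Pi.mul_apply, ← congrFun (hf2 a b) x, ← congrFun (hg2 a b) x]
    simp only [slashZ, Pi.mul_apply]
    have : cexp (2 * π * I * (((p + q : ℕ) : ℂ) * ((a : ℂ) ^ 2 * x.1 + 2 * a * x.2))) =
        cexp (2 * π * I * (p * ((a : ℂ) ^ 2 * x.1 + 2 * a * x.2))) *
        cexp (2 * π * I * (q * ((a : ℂ) ^ 2 * x.1 + 2 * a * x.2))) := by
      rw [← Complex.exp_add]
      congr 1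
      push_cast
      ring
    rw [this]
    ring

lemma one_mem_weakJacobiForms : (1 : ℍ × ℂ → ℂ) ∈ weakJacobiForms 0 0 := by
  refine ⟨differentiableOn_const 1, fun γ => ?_, fun a b => ?_, Pi.single 0 1, fun N hN => ?_,
    fun x => ?_⟩
  · ext x; simp [slashSL]
  · ext x; simp [slashZ]
  · have : N = 0 := by
      by_contra h
      exact hN (by simp [h])
    simp [this]
  · have := hasSum_single (f := fun N => (Pi.single 0 1 : ℕ × ℤ → ℂ) N * fourierMode N x) 0
      fun N hN => by simp [hN]
    simpa [fourierMode] using! this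

instance : SetLike.GradedMonoid evComponent where
  one_mem := one_mem_weakJacobiForms
  mul_mem := by
    rintro ⟨i, p⟩ ⟨j, q⟩ f g hf hg
    have := mul_mem_weakJacobiForms hf hg
    rwa [← mul_add] at this

/-- The bigraded algebra `⨁ J̃_{k,m}` over even integers `k` and natural numbers `m`. -/
abbrev EvWeakJacobi : Type := ⨁ i, evComponent i

/-! ### The functions `ζ`, `J₁`, `J₂` and the operator -/

/-- The period pair `(1, τ)`; its lattice is `ℤ + τ ℤ`. -/
def periods (τ : ℍ) : PeriodPair where
  ω₁ := 1
  ω₂ := τ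
  indep := by
    rw [LinearIndependent.pair_iff]
    intro s t h
    have h1 := congrArg Complex.im h
    have h2 := congrArg Complex.re h
    have ht : t = 0 := by simpa [τ.im_ne_zero] using h1
    subst ht
    simpa using h2

/-- The lattice `ℤ + τ ℤ`. -/
def latt (τ : ℍ) : Submodule ℤ ℂ := (periods τ).lattice

/-- The Weierstrass zeta function of the lattice `ℤ + τ ℤ`. -/
def zeta (τ : ℍ) (z : ℂ) : ℂ :=
  1 / z + ∑' w : {w : latt τ // w ≠ 0},
    (1 / (z - (w : ℂ)) + 1 / (w : ℂ) + z / (w : ℂ) ^ 2)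

/-- `(2πi)⁻¹ ∂/∂τ`. -/
def Dτ (f : ℍ × ℂ → ℂ) : ℍ × ℂ → ℂ := fun x =>
  (2 * π * I)⁻¹ * deriv (fun t : ℂ => f (ofComplex t, x.2)) x.1

/-- `(2πi)⁻¹ ∂/∂z`. -/
def Dz (f : ℍ × ℂ → ℂ) : ℍ × ℂ → ℂ := fun x =>
  (2 * π * I)⁻¹ * deriv (fun w : ℂ => f (x.1, w)) x.2

/-- The function `J₁`, meaningful for `z` outside the lattice. -/
def J₁ : ℍ × ℂ → ℂ := fun x =>
  (2 * π * I)⁻¹ * zeta x.1 x.2 + π * I / 6 * x.2 * EisensteinSeries.E2 x.1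

/-- The function `J₂`, meaningful for `z` outside the lattice. -/
def J₂ : ℍ × ℂ → ℂ := fun x =>
  Dz J₁ x - 1 / 12 * EisensteinSeries.E2 x.1 + J₁ x ^ 2

/-- The expression `D_τ f - (k/12) E₂ f - J₁ D_z f + p J₂ f`, meaningful for `z` outside the
lattice. -/
def obFormula (k : ℤ) (p : ℕ) (f : ℍ × ℂ → ℂ) : ℍ × ℂ → ℂ := fun x =>
  Dτ f x - (k : ℂ) / 12 * EisensteinSeries.E2 x.1 * f x - J₁ x * Dz f x + (p : ℂ) * J₂ x * f x

open scoped Classical in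
/-- The operator `Ob` in weight `k` and index `p`: it is given by the formula at `(τ, z)` for `z`
outside the lattice, and by the limit of the formula as the second variable tends to `z` if `z`
lies in the lattice, where `J₁` and `J₂` are not defined. -/
def Ob (k : ℤ) (p : ℕ) (f : ℍ × ℂ → ℂ) : ℍ × ℂ → ℂ := fun x =>
  if x.2 ∈ latt x.1 then limUnder (𝓝[≠] x.2) (fun w : ℂ => obFormula k p f (x.1, w))
  else obFormula k p f x

/-- A derivation of the bigraded algebra that is given by `Ob` on every homogeneous component. -/
def ExtendsOb (D : Derivation ℂ EvWeakJacobi EvWeakJacobi) : Prop :=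
  ∀ (j : ℤ) (p : ℕ) (f : evComponent (j, p)),
    ∃ h : Ob (2 * j) p f ∈ evComponent (j + 1, p),
      D (DirectSum.of (fun i => evComponent i) (j, p) f) =
        DirectSum.of (fun i => evComponent i) (j + 1, p) ⟨Ob (2 * j) p f, h⟩

/-! ### Modular forms as functions of two variables -/

/-- A function on `ℍ` seen as a function on `ℍ × ℂ` that does not depend on `z`. -/
def pull (f : ℍ → ℂ) : ℍ × ℂ → ℂ := fun x => f x.1

end

end WeakJacobi

/-! `J₁` behaves like a connection. With X = cz/(cτ+d) it becomes (cτ+d)(J₁ + X) under SL(2, ℤ), and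
J₁ − a under z ↦ z + aτ + b. The errors picked up by D_τ f, D_z f, E₂ and J₂ are built from the same
X or a, and the coefficients of the formula make them all cancel (`obFormula_smul`,
`obFormula_add`). The two laws of `J₁` come from the homogeneity of ζ, the quasi-modularity of E₂
and a cotangent series in Eisenstein order (`hasSum_cot_zeta`).

At z = 0 the double poles of D_z J₁ and J₁² cancel in J₂. The term J₁ D_z f is regular because f is
even in z for even k, so that D_z f(τ, 0) = 0. Elliptic invariance carries this to every lattice
point, so Ob(f) is entire in z.

For the Fourier expansion, `J₁` is a sum of geometric series in the strip 0 < im z < im τ, with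
nonnegative powers of q only; hence Ob(f) has such an expansion there. Contour integrals define
coefficients c(n, r) for all integers n, zero for n < 0, and ellipticity gives c(n, r) = c(n + pl² +
rl, r + 2pl). This forces r² ≤ 4np + p². The bound makes the series converge on all of ℍ × ℂ, and
the identity theorem identifies its sum with Ob(f); joint holomorphy is a by-product
(`isHolo_and_hasWeakFourierExpansion`).

The Leibniz rule holds because the first-order terms are derivations and the zeroth-order
coefficients are additive in (k, p). On functions of τ alone in index 0 only the Serre derivative
survives. -/

namespace WeakJacobi

noncomputable section

/-! ### Absolutely convergent Fourier expansions -/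

/-- `F = ∑ c(n, r) exp (2πi (n τ + r z))` at all points with `(im τ, im z) ∈ V`. -/
def ExpandsOn (V : Set (ℝ × ℝ)) (c : ℕ × ℤ → ℂ) (F : ℍ × ℂ → ℂ) : Prop :=
  ∀ x : ℍ × ℂ, (x.1.im, x.2.im) ∈ V → HasSum (fun N => c N * fourierMode N x) (F x)

/-- The function `F` has a Fourier expansion at all points with `(im τ, im z) ∈ V`. -/
def Expandable (V : Set (ℝ × ℝ)) (F : ℍ × ℂ → ℂ) : Prop := ∃ c, ExpandsOn V c F

/-- The strip `0 < im z < im τ`. -/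
def strip : Set (ℝ × ℝ) := {v | 0 < v.2 ∧ v.2 < v.1}

lemma isOpen_strip : IsOpen strip :=
  (isOpen_lt continuous_const continuous_snd).inter (isOpen_lt continuous_snd continuous_fst)

lemma norm_cexp_mode (n : ℕ) (r : ℤ) (t z : ℂ) :
    ‖cexp (2 * π * I * ((n : ℂ) * t + (r : ℂ) * z))‖ =
      Real.exp (-(2 * π * (n * t.im + r * z.im))) := by
  rw [Complex.norm_exp]
  congr 1
  simp

lemma norm_fourierMode (N : ℕ × ℤ) (x : ℍ × ℂ) :
    ‖fourierMode N x‖ = Real.exp (-(2 * π * (N.1 * x.1.im + N.2 * x.2.im))) :=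
  norm_cexp_mode _ _ _ _

lemma hasDerivAt_fourierMode (N : ℕ × ℤ) (τ : ℍ) (z : ℂ) :
    HasDerivAt (fun w => fourierMode N (τ, w))
      (fourierMode N (τ, z) * (2 * π * I * (N.2 * 1))) z :=
  HasDerivAt.cexp (f := fun w => 2 * π * I * ((N.1 : ℂ) * τ + (N.2 : ℂ) * w))
    ((((hasDerivAt_id' z).const_mul (N.2 : ℂ)).const_add _).const_mul _)

/-- Grouping the terms by exponent gives coefficients independent of the point, so products and
multiple geometric series need not be indexed by their exponents. -/
lemma Expandable.of_hasSum {V : Set (ℝ × ℝ)} {F : ℍ × ℂ → ℂ} {ι : Type*} (s : ι → ℕ × ℤ)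
    (a : ι → ℂ)
    (h : ∀ x : ℍ × ℂ, (x.1.im, x.2.im) ∈ V →
      HasSum (fun i => a i * fourierMode (s i) x) (F x)) : Expandable V F := by
  refine ⟨fun N => ∑' i : {i // s i = N}, a i, fun x hx => ?_⟩
  have h1 := h x hx
  rw [← (Equiv.sigmaFiberEquiv s).hasSum_iff] at h1
  refine h1.sigma fun N => ?_
  have h2 := (h1.summable.sigma_factor N).hasSum
  convert! h2 using 1
  rw [← tsum_mul_right]
  refine tsum_congr fun ⟨y, hy⟩ => ?_
  simp only [Function.comp, Equiv.sigmaFiberEquiv_apply]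
  rw [← hy]

namespace ExpandsOn

variable {V W : Set (ℝ × ℝ)} {c d : ℕ × ℤ → ℂ} {F G : ℍ × ℂ → ℂ}

lemma mono (h : ExpandsOn V c F) (hW : W ⊆ V) : ExpandsOn W c F := fun x hx => h x (hW hx)

lemma add (hF : ExpandsOn V c F) (hG : ExpandsOn V d G) : ExpandsOn V (c + d) (F + G) :=
  fun x hx => by simpa [add_mul] using (hF x hx).add (hG x hx)

lemma const_smul (hF : ExpandsOn V c F) (s : ℂ) : ExpandsOn V (s • c) (s • F) :=
  fun x hx => by simpa [mul_assoc] using (hF x hx).mul_left s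

lemma mul (hF : ExpandsOn V c F) (hG : ExpandsOn V d G) : Expandable V (F * G) := by
  refine Expandable.of_hasSum (fun y : (ℕ × ℤ) × (ℕ × ℤ) => y.1 + y.2)
    (fun y => c y.1 * d y.2) fun x hx => ?_
  have h0 : Summable fun y : (ℕ × ℤ) × (ℕ × ℤ) =>
      (c y.1 * fourierMode y.1 x) * (d y.2 * fourierMode y.2 x) :=
    summable_mul_of_summable_norm (f := fun N => c N * fourierMode N x)
      (g := fun N => d N * fourierMode N x) (hF x hx).summable.norm (hG x hx).summable.norm
  refine ((hF x hx).mul (hG x hx) h0).congr_fun fun y => ?_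
  rw [fourierMode_add]
  ring

/-- Termwise differentiation: the norm of a mode is monotone in im z, so near z it is dominated by
its value at z + iε/2 or z − iε/2. Openness of `V` makes room for these two points. -/
lemma dz (hV : IsOpen V) (hF : ExpandsOn V c F) :
    ExpandsOn V (fun N => N.2 * c N) (Dz F) := by
  rintro ⟨τ, z⟩ hx
  have hcont : Continuous fun s : ℝ => (τ.im, s) := by fun_prop
  obtain ⟨ε, hε, hball⟩ := Metric.isOpen_iff.mp (hV.preimage hcont) z.im hx
  have hsub : ∀ w ∈ Metric.ball z ε, (τ.im, w.im) ∈ V := fun w hw => hball <| by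
    rw [Metric.mem_ball, Real.dist_eq, ← sub_im]
    exact (abs_im_le_norm _).trans_lt (by rwa [← dist_eq_norm])
  have h1 := (hF (τ, z + (ε / 2 : ℝ) * I) (hsub _ (by
    simp [abs_of_pos hε, hε]))).summable.norm
  have h2 := (hF (τ, z - (ε / 2 : ℝ) * I) (hsub _ (by
    simp [abs_of_pos hε, hε]))).summable.norm
  have key := hasSum_deriv_of_summable_norm (U := Metric.ball z (ε / 2)) (z := z)
    (F := fun (N : ℕ × ℤ) w => c N * fourierMode N (τ, w)) (h1.add h2)
    (fun N w _ =>
      ((hasDerivAt_fourierMode N τ w).differentiableAt.const_mul _).differentiableWithinAt) Metric.isOpen_ball (fun N w hw => by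
      have hw' : |w.im - z.im| < ε / 2 := by
        rw [← sub_im]
        exact (abs_im_le_norm _).trans_lt (by rwa [← dist_eq_norm])
      rw [abs_lt] at hw'
      simp only [norm_mul, ← mul_add]
      refine mul_le_mul_of_nonneg_left ?_ (norm_nonneg _)
      simp only [norm_fourierMode]
      -- For r ≥ 0 the lower point dominates, for r ≤ 0 the upper one.
      rcases le_total 0 N.2 with h | h
      · have h' : (0 : ℝ) ≤ N.2 := by exact_mod_cast h
        refine le_add_of_nonneg_of_le (Real.exp_nonneg _) (Real.exp_le_exp.mpr ?_)
        have : (N.2 : ℝ) * (z.im - ε / 2) ≤ N.2 * w.im :=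
          mul_le_mul_of_nonneg_left (by linarith) h'
        have := Real.pi_pos
        simp
        nlinarith
      · have h' : (N.2 : ℝ) ≤ 0 := by exact_mod_cast h
        refine le_add_of_le_of_nonneg (Real.exp_le_exp.mpr ?_) (Real.exp_nonneg _)
        have : (N.2 : ℝ) * (z.im + ε / 2) ≤ N.2 * w.im :=
          mul_le_mul_of_nonpos_left (by linarith) h'
        have := Real.pi_pos
        simp
        nlinarith) (Metric.mem_ball_self (by positivity))
  have heq : deriv (fun w => ∑' N, c N * fourierMode N (τ, w)) z = deriv (fun w => F (τ, w)) z := by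
    refine Filter.EventuallyEq.deriv_eq ?_
    filter_upwards [Metric.ball_mem_nhds z hε] with w hw
    exact (hF (τ, w) (hsub w hw)).tsum_eq
  rw [heq] at key
  refine (key.mul_left (2 * π * I : ℂ)⁻¹).congr_fun fun N => ?_
  rw [((hasDerivAt_fourierMode N τ z).const_mul (c N)).deriv]
  field_simp

/-- Since n ≥ 0, every mode decays as im τ grows, so a single comparison point below τ suffices. -/
lemma dτ (hV : IsOpen V) (hF : ExpandsOn V c F) :
    ExpandsOn V (fun N => N.1 * c N) (Dτ F) := by
  rintro ⟨τ, z⟩ hx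
  have hcont : Continuous fun s : ℝ => (s, z.im) := by fun_prop
  obtain ⟨ε, hε, hball⟩ := Metric.isOpen_iff.mp
    ((hV.preimage hcont).inter (isOpen_lt continuous_const continuous_id)) τ.im ⟨hx, τ.im_pos⟩
  have hsub : ∀ w ∈ Metric.ball (τ : ℂ) ε, (w.im, z.im) ∈ V ∧ 0 < w.im := fun w hw => hball <| by
    rw [Metric.mem_ball, Real.dist_eq, ← UpperHalfPlane.coe_im, ← sub_im]
    exact (abs_im_le_norm _).trans_lt (by rwa [← dist_eq_norm])
  have hm := hsub ((τ : ℂ) - (ε / 2 : ℝ) * I) (by simp [abs_of_pos hε, hε])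
  have h1 := (hF (⟨_, hm.2⟩, z) hm.1).summable.norm
  have key := hasSum_deriv_of_summable_norm (U := Metric.ball (τ : ℂ) (ε / 2)) (z := (τ : ℂ))
    (F := fun (N : ℕ × ℤ) w => c N * cexp (2 * π * I * ((N.1 : ℂ) * w + (N.2 : ℂ) * z))) h1
    (fun N => by fun_prop) Metric.isOpen_ball (fun N w hw => by
      have hw' : |w.im - τ.im| < ε / 2 := by
        rw [← UpperHalfPlane.coe_im, ← sub_im]
        exact (abs_im_le_norm _).trans_lt (by rwa [← dist_eq_norm])
      rw [abs_lt] at hw'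
      simp only [norm_mul]
      refine mul_le_mul_of_nonneg_left ?_ (norm_nonneg _)
      rw [norm_fourierMode, norm_cexp_mode]
      refine Real.exp_le_exp.mpr ?_
      have : (N.1 : ℝ) * (τ.im - ε / 2) ≤ N.1 * w.im :=
        mul_le_mul_of_nonneg_left (by linarith) (by positivity)
      have := Real.pi_pos
      have h2 : (UpperHalfPlane.mk ((τ : ℂ) - (ε / 2 : ℝ) * I) hm.2).im = τ.im - ε / 2 := by
        simp [← UpperHalfPlane.coe_im]
      simp only [h2]
      nlinarith) (Metric.mem_ball_self (by positivity))
  have heq : deriv (fun w => ∑' N : ℕ × ℤ, c N *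
      cexp (2 * π * I * ((N.1 : ℂ) * w + (N.2 : ℂ) * z))) (τ : ℂ) =
      deriv (fun w => F (ofComplex w, z)) τ := by
    refine Filter.EventuallyEq.deriv_eq ?_
    filter_upwards [Metric.ball_mem_nhds (τ : ℂ) hε] with w hw
    have := (hF (ofComplex w, z) (by
      rw [ofComplex_apply_of_im_pos (hsub w hw).2]; exact (hsub w hw).1)).tsum_eq
    rw [← this]
    simp only [fourierMode, ofComplex_apply_of_im_pos (hsub w hw).2]
  rw [heq] at key
  refine (key.mul_left (2 * π * I : ℂ)⁻¹).congr_fun fun N => ?_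
  have hd : HasDerivAt (fun w => c N * cexp (2 * π * I * ((N.1 : ℂ) * w + (N.2 : ℂ) * z)))
      (c N * (fourierMode N (τ, z) * (2 * π * I * (N.1 * 1)))) τ :=
    ((((hasDerivAt_id (τ : ℂ)).const_mul (N.1 : ℂ)).add_const _).const_mul _).cexp.const_mul _
  rw [hd.deriv]
  field_simp

lemma isHolo (hF : ExpandsOn Set.univ c F) : IsHolo F := by
  rintro ⟨t, z⟩ ht
  simp only [Set.mem_ofPred_eq] at ht
  refine DifferentiableAt.differentiableWithinAt ?_
  -- Only imaginary parts affect norms, so the comparison point may be taken purely imaginary, at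
  -- half the height of t. With z ± i it dominates all modes on the product of balls.
  set τ' : ℍ := ⟨(t.im / 2 : ℝ) * I, by simpa using! ht⟩ with hτ'
  have him : τ'.im = t.im / 2 := by simp [hτ', ← UpperHalfPlane.coe_im]
  let u : ℂ → ℕ × ℤ → ℝ := fun w N => ‖N.1 * c N * fourierMode N (τ', w)‖ +
    ‖N.2 * c N * fourierMode N (τ', w)‖
  have hu : ∀ w, Summable (u w) := fun w =>
    ((hF.dτ isOpen_univ) (τ', w) trivial).summable.norm.add
      ((hF.dz isOpen_univ) (τ', w) trivial).summable.norm
  let f : ℕ × ℤ → ℂ × ℂ → ℂ := fun N x =>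
    c N * cexp (2 * π * I * ((N.1 : ℂ) * x.1 + (N.2 : ℂ) * x.2))
  let f' : ℕ × ℤ → ℂ × ℂ → ℂ × ℂ →L[ℂ] ℂ := fun N x =>
    c N • (cexp (2 * π * I * ((N.1 : ℂ) * x.1 + (N.2 : ℂ) * x.2)) • ((2 * π * I : ℂ) •
      ((N.1 : ℂ) • ContinuousLinearMap.fst ℂ ℂ ℂ + (N.2 : ℂ) • ContinuousLinearMap.snd ℂ ℂ ℂ)))
  have hball : ∀ x ∈ Metric.ball t (t.im / 2) ×ˢ Metric.ball z 1,
      t.im / 2 ≤ x.1.im ∧ z.im - 1 ≤ x.2.im ∧ x.2.im ≤ z.im + 1 := by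
    rintro x ⟨h1, h2⟩
    have h1' := (abs_im_le_norm (x.1 - t)).trans_lt (by rwa [← dist_eq_norm])
    have h2' := (abs_im_le_norm (x.2 - z)).trans_lt (by rwa [← dist_eq_norm])
    rw [sub_im, abs_lt] at h1' h2'
    exact ⟨by linarith, by linarith, by linarith⟩
  have key := hasFDerivAt_tsum_of_isPreconnected (𝕜 := ℂ) (f := f) (f' := f')
    (u := fun N => 2 * π * (u (z + I) N + u (z - I) N))
    (s := Metric.ball t (t.im / 2) ×ˢ Metric.ball z 1) (x₀ := (t, z)) (x := (t, z))
    (((hu _).add (hu _)).mul_left _) (Metric.isOpen_ball.prod Metric.isOpen_ball)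
    (((convex_ball _ _).prod (convex_ball _ _)).isPreconnected)
    (fun N x _ => ((((hasFDerivAt_fst.const_mul (N.1 : ℂ)).add
      (hasFDerivAt_snd.const_mul (N.2 : ℂ))).const_mul _).cexp.const_mul _))
    (fun N x hx => ?_) ⟨Metric.mem_ball_self (by positivity), Metric.mem_ball_self one_pos⟩
    (by
      have := (hF (⟨t, ht⟩, z) trivial).summable
      simpa [f, fourierMode] using! this)
    ⟨Metric.mem_ball_self (by positivity), Metric.mem_ball_self one_pos⟩
  · refine key.differentiableAt.congr_of_eventuallyEq ?_
    have ho : IsOpen {x : ℂ × ℂ | 0 < x.1.im} :=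
      isOpen_lt continuous_const (Complex.continuous_im.comp continuous_fst)
    filter_upwards [ho.mem_nhds (show (t, z) ∈ {x : ℂ × ℂ | 0 < x.1.im} from ht)] with x hx
    rw [← (hF (ofComplex x.1, x.2) trivial).tsum_eq]
    simp [f, fourierMode, ofComplex_apply_of_im_pos hx]
  · obtain ⟨b1, b2, b3⟩ := hball x hx
    have hlin : ‖(N.1 : ℂ) • ContinuousLinearMap.fst ℂ ℂ ℂ +
        (N.2 : ℂ) • ContinuousLinearMap.snd ℂ ℂ ℂ‖ ≤ ‖(N.1 : ℂ)‖ + ‖(N.2 : ℂ)‖ := by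
      refine (norm_add_le _ _).trans (add_le_add ?_ ?_)
      · rw [norm_smul]
        exact mul_le_of_le_one_right (norm_nonneg _) (ContinuousLinearMap.norm_fst_le ℂ ℂ ℂ)
      · rw [norm_smul]
        exact mul_le_of_le_one_right (norm_nonneg _) (ContinuousLinearMap.norm_snd_le ℂ ℂ ℂ)
    have hE : ‖cexp (2 * π * I * ((N.1 : ℂ) * x.1 + (N.2 : ℂ) * x.2))‖ ≤
        ‖fourierMode N (τ', z + I)‖ + ‖fourierMode N (τ', z - I)‖ := by
      rw [norm_cexp_mode, norm_fourierMode, norm_fourierMode]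
      have hn : (N.1 : ℝ) * (t.im / 2) ≤ N.1 * x.1.im :=
        mul_le_mul_of_nonneg_left b1 (by positivity)
      have hp := Real.pi_pos
      rcases le_total 0 N.2 with h | h
      · have h' : (0 : ℝ) ≤ N.2 := by exact_mod_cast h
        refine le_add_of_nonneg_of_le (Real.exp_nonneg _) (Real.exp_le_exp.mpr ?_)
        have := mul_le_mul_of_nonneg_left b2 h'
        simp only [him, sub_im, Complex.I_im]
        nlinarith
      · have h' : (N.2 : ℝ) ≤ 0 := by exact_mod_cast h
        refine le_add_of_le_of_nonneg (Real.exp_le_exp.mpr ?_) (Real.exp_nonneg _)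
        have := mul_le_mul_of_nonpos_left b3 h'
        simp only [him, add_im, Complex.I_im]
        nlinarith
    have h2π : ‖(2 * π * I : ℂ)‖ = 2 * π := by simp [abs_of_pos Real.pi_pos]
    simp only [f', u, norm_smul, norm_mul, h2π]
    calc _ ≤ ‖c N‖ * ((‖fourierMode N (τ', z + I)‖ + ‖fourierMode N (τ', z - I)‖) *
          (2 * π * (‖(N.1 : ℂ)‖ + ‖(N.2 : ℂ)‖))) := by gcongr
      _ = _ := by ring

end ExpandsOn

/-! ### Extraction of Fourier coefficients -/

lemma integral_cexp_int (k : ℤ) (s : ℝ) :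
    ∫ y in (0 : ℝ)..1, cexp (2 * π * I * (k * (y + s * I))) = if k = 0 then 1 else 0 := by
  split_ifs with hk
  · simp [hk]
  · have h0 : (2 * π * I * k : ℂ) ≠ 0 := by simp [hk, Real.pi_ne_zero]
    have h1 : ∀ y : ℝ, cexp (2 * π * I * (k * (y + s * I))) =
        cexp (2 * π * I * k * (s * I)) * cexp (2 * π * I * k * y) := fun y => by
      rw [← Complex.exp_add]
      congr 1
      ring
    simp_rw [h1]
    rw [intervalIntegral.integral_const_mul, integral_exp_mul_complex h0]
    have h2 : cexp (2 * π * I * k) = 1 := by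
      rw [mul_comm]
      exact Complex.exp_int_mul_two_pi_mul_I k
    simp [h2]

/-- The Fourier coefficients of an absolutely convergent exponential sum. -/
lemma hasSum_coeff {ι : Type*} [Countable ι] {a : ι → ℂ} {k : ι → ℤ} {g : ℂ → ℂ} {s : ℝ}
    (h : ∀ y : ℝ, HasSum (fun i => a i * cexp (2 * π * I * (k i * (y + s * I)))) (g (y + s * I)))
    (r : ℤ) :
    HasSum (fun i => if k i = r then a i else 0)
      (∫ y in (0 : ℝ)..1, g (y + s * I) * cexp (-(2 * π * I * (r * (y + s * I))))) := by
  have hn : ∀ (j : ℤ) (y : ℝ), ‖cexp (2 * π * I * (j * (y + s * I)))‖ =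
      Real.exp (-(2 * π * (j * s))) := fun j y => by
    rw [Complex.norm_exp]; congr 1; simp
  have hn' : ∀ (j : ℤ) (y : ℝ), ‖cexp (-(2 * π * I * (j * (y + s * I))))‖ =
      Real.exp (2 * π * (j * s)) := fun j y => by
    rw [Complex.norm_exp]; congr 1; simp
  have hs := (h 0).summable.norm
  have key := intervalIntegral.hasSum_integral_of_dominated_convergence
    (μ := MeasureTheory.volume) (a := 0) (b := 1)
    (F := fun i (y : ℝ) => a i * cexp (2 * π * I * (k i * (y + s * I))) *
      cexp (-(2 * π * I * (r * (y + s * I)))))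
    (f := fun y : ℝ => g (y + s * I) * cexp (-(2 * π * I * (r * (y + s * I)))))
    -- On a horizontal line the norm of each term is independent of y, so its value at y = 0 is a
    -- dominating constant.
    (fun i _ => ‖a i * cexp (2 * π * I * (k i * ((0 : ℝ) + s * I)))‖ *
      Real.exp (2 * π * (r * s)))
    (fun i => Continuous.aestronglyMeasurable (by fun_prop))
    (fun i => .of_forall fun y _ => by simp only [norm_mul, hn, hn']; rfl)
    (.of_forall fun y _ => hs.mul_right _)
    intervalIntegrable_const
    (.of_forall fun y _ => (h y).mul_right _)
  refine key.congr_fun fun i => ?_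
  have h1 : ∀ y : ℝ, a i * cexp (2 * π * I * (k i * (y + s * I))) *
      cexp (-(2 * π * I * (r * (y + s * I)))) =
      a i * cexp (2 * π * I * ((k i - r : ℤ) * (y + s * I))) := fun y => by
    rw [mul_assoc, ← Complex.exp_add]
    congr 2
    push_cast
    ring
  simp_rw [h1]
  rw [intervalIntegral.integral_const_mul, integral_cexp_int]
  simp [sub_eq_zero]

/-- The integral of a periodic entire function over a horizontal period does not depend on the
initial point. -/
lemma integral_add_eq_of_periodic {g : ℂ → ℂ} (hg : Differentiable ℂ g)
    (hp : ∀ z, g (z + 1) = g z) (w : ℂ) :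
    ∫ y in (0 : ℝ)..1, g (y + w) = ∫ y in (0 : ℝ)..1, g y := by
  have h1 : ∫ y in (0 : ℝ)..1, g (y + w) = ∫ y in (0 : ℝ)..1, g (y + w.im * I) := by
    have hper : Function.Periodic (fun y : ℝ => g (y + w.im * I)) 1 := fun y => by
      change g _ = g _
      rw [← hp (y + w.im * I)]
      congr 1
      push_cast
      ring
    have := hper.intervalIntegral_add_eq w.re 0
    rw [zero_add] at this
    rw [← this]
    have h2 := intervalIntegral.integral_comp_add_right (a := 0) (b := 1)
      (fun y : ℝ => g (y + w.im * I)) w.re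
    rw [zero_add, add_comm (1 : ℝ)] at h2
    rw [← h2]
    refine intervalIntegral.integral_congr fun y _ => ?_
    congr 1
    push_cast
    rw [add_assoc, Complex.re_add_im]
  -- Cauchy's theorem on a rectangle of width one, whose vertical sides cancel by periodicity.
  have h3 := integral_boundary_rect_eq_zero_of_differentiableOn g 0 (1 + w.im * I)
    hg.differentiableOn
  have h4 : ∫ y in (0 : ℝ)..w.im, g (1 + y * I) = ∫ y in (0 : ℝ)..w.im, g (0 + y * I) := by
    refine intervalIntegral.integral_congr fun y _ => ?_
    rw [← hp (0 + _)]
    congr 1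
    ring
  simp at h3 h4
  rw [h1]
  rw [h4] at h3
  linear_combination -h3

end

end WeakJacobi

namespace WeakJacobi

noncomputable section

/-! ### Fourier coefficients of elliptic functions and their support -/

lemma IsHolo.differentiable_right {F : ℍ × ℂ → ℂ} (hF : IsHolo F) (τ : ℍ) :
    Differentiable ℂ fun z => F (τ, z) := fun z => by
  have ho : IsOpen {x : ℂ × ℂ | 0 < x.1.im} :=
    isOpen_lt continuous_const (Complex.continuous_im.comp continuous_fst)
  have h1 := (hF ((τ : ℂ), z) τ.im_pos).differentiableAt (ho.mem_nhds τ.im_pos)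
  have h2 : DifferentiableAt ℂ (fun w : ℂ => ((τ : ℂ), w)) z := by fun_prop
  have h3 := DifferentiableAt.comp z h1 h2
  simpa [Function.comp_def] using h3

/-- The Fourier coefficient in `z` of index `r`. -/
def zCoeff (F : ℍ × ℂ → ℂ) (r : ℤ) (τ : ℍ) : ℂ :=
  ∫ y in (0 : ℝ)..1, F (τ, y) * cexp (-(2 * π * I * (r * y)))

/-- The Fourier coefficient in `τ` of index `n` of the Fourier coefficient in `z` of index `r`. -/
def qzCoeff (F : ℍ × ℂ → ℂ) (n r : ℤ) : ℂ :=
  ∫ x in (0 : ℝ)..1, zCoeff F r (ofComplex (x + (1 : ℝ) * I)) *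
    cexp (-(2 * π * I * (n * (x + (1 : ℝ) * I))))

section

variable {p : ℕ} {F : ℍ × ℂ → ℂ} {c : ℕ × ℤ → ℂ}

lemma add_one_eq_of_slashZ (hell : ∀ a b, slashZ p a b F = F) (τ : ℍ) (z : ℂ) :
    F (τ, z + 1) = F (τ, z) := by
  have := congrFun (hell 0 1) (τ, z)
  simpa [slashZ] using this

/-- The integrand is entire and 1-periodic, so the contour can be moved: by lτ to use ellipticity,
or to height im τ/2 to enter the strip. -/
lemma zCoeff_eq (hd : ∀ τ, Differentiable ℂ fun z => F (τ, z))
    (hell : ∀ a b, slashZ p a b F = F) (r : ℤ) (τ : ℍ) (w : ℂ) :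
    zCoeff F r τ =
      ∫ y in (0 : ℝ)..1, F (τ, y + w) * cexp (-(2 * π * I * (r * (y + w)))) := by
  refine (integral_add_eq_of_periodic (g := fun z => F (τ, z) * cexp (-(2 * π * I * (r * z))))
    ((hd τ).mul (by fun_prop)) (fun z => ?_) w).symm
  rw [add_one_eq_of_slashZ hell]
  congr 1
  have : -(2 * π * I * (r * (z + 1)) : ℂ) = -(2 * π * I * (r * z)) + (-r : ℤ) * (2 * π * I) := by
    push_cast; ring
  rw [this, Complex.exp_add, Complex.exp_int_mul_two_pi_mul_I, mul_one]

/-- Move the contour by lτ and apply the elliptic law; completing the exponent shifts r by 2pl and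
leaves a power of q. -/
lemma zCoeff_add (hd : ∀ τ, Differentiable ℂ fun z => F (τ, z))
    (hell : ∀ a b, slashZ p a b F = F) (r l : ℤ) (τ : ℍ) :
    zCoeff F (r + 2 * p * l) τ =
      cexp (2 * π * I * ((p * l ^ 2 + r * l : ℤ) * τ)) * zCoeff F r τ := by
  rw [zCoeff_eq hd hell r τ (l * τ), ← intervalIntegral.integral_const_mul]
  refine intervalIntegral.integral_congr fun y _ => ?_
  have h := congrFun (hell l 0) (τ, y)
  simp only [slashZ, Int.cast_zero, add_zero] at h
  have hE : cexp (2 * π * I * (p * ((l : ℂ) ^ 2 * τ + 2 * l * y))) *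
      cexp (-(2 * π * I * ((r + 2 * p * l : ℤ) * y))) =
      cexp (2 * π * I * ((p * l ^ 2 + r * l : ℤ) * τ)) *
      cexp (-(2 * π * I * (r * (y + l * τ)))) := by
    rw [← Complex.exp_add, ← Complex.exp_add]
    congr 1
    push_cast
    ring
  rw [← h]
  linear_combination F (τ, y + l * τ) * hE

lemma hasSum_zCoeff (hd : ∀ τ, Differentiable ℂ fun z => F (τ, z))
    (hell : ∀ a b, slashZ p a b F = F) (hF : ExpandsOn strip c F) (r : ℤ) (τ : ℍ) :
    HasSum (fun N => if N.2 = r then c N * cexp (2 * π * I * ((N.1 : ℤ) * (τ : ℂ))) else 0)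
      (zCoeff F r τ) := by
  rw [zCoeff_eq hd hell r τ ((τ.im / 2 : ℝ) * I)]
  refine hasSum_coeff (a := fun N => c N * cexp (2 * π * I * ((N.1 : ℤ) * (τ : ℂ))))
    (k := fun N => N.2) (g := fun z => F (τ, z)) (fun y => ?_) r
  have := τ.im_pos
  refine (hF (τ, y + (τ.im / 2 : ℝ) * I) ⟨?_, ?_⟩).congr_fun fun N => ?_
  · simpa using this
  · simpa using this
  · rw [mul_assoc, ← Complex.exp_add, fourierMode]
    congr 2
    push_cast
    ring

lemma qzCoeff_add (hd : ∀ τ, Differentiable ℂ fun z => F (τ, z))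
    (hell : ∀ a b, slashZ p a b F = F) (n r l : ℤ) :
    qzCoeff F n (r + 2 * p * l) = qzCoeff F (n - (p * l ^ 2 + r * l)) r := by
  refine intervalIntegral.integral_congr fun x _ => ?_
  rw [zCoeff_add hd hell, ofComplex_apply_of_im_pos (by simp), mul_comm (cexp _), mul_assoc,
    ← Complex.exp_add]
  congr 2
  push_cast
  ring

lemma hasSum_qzCoeff (hd : ∀ τ, Differentiable ℂ fun z => F (τ, z))
    (hell : ∀ a b, slashZ p a b F = F) (hF : ExpandsOn strip c F) (n r : ℤ) :
    HasSum (fun N => if (N.1 : ℤ) = n then (if N.2 = r then c N else 0) else 0)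
      (qzCoeff F n r) := by
  refine hasSum_coeff (a := fun N => if N.2 = r then c N else 0)
    (k := fun N : ℕ × ℤ => (N.1 : ℤ)) (g := fun t => zCoeff F r (ofComplex t)) (fun y => ?_) n
  refine (hasSum_zCoeff hd hell hF r _).congr_fun fun N => ?_
  rw [ite_mul, zero_mul, ofComplex_apply_of_im_pos (by simp)]

/-- The integral makes sense for every integer n, which lets the shift relation leave the range n ≥
0; there it recovers the given coefficients, and for n < 0 it vanishes. -/
lemma qzCoeff_natCast (hd : ∀ τ, Differentiable ℂ fun z => F (τ, z))
    (hell : ∀ a b, slashZ p a b F = F) (hF : ExpandsOn strip c F) (n : ℕ) (r : ℤ) :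
    qzCoeff F n r = c (n, r) := by
  refine (hasSum_qzCoeff hd hell hF n r).unique ?_
  convert! hasSum_single (f := fun N : ℕ × ℤ => if (N.1 : ℤ) = n then
    (if N.2 = r then c N else 0) else 0) (n, r) fun N hN => ?_
  · simp
  · simp only [Nat.cast_inj]
    split_ifs with h1 h2
    · exact absurd (Prod.ext h1 h2) hN
    · rfl
    · rfl

lemma qzCoeff_of_neg (hd : ∀ τ, Differentiable ℂ fun z => F (τ, z))
    (hell : ∀ a b, slashZ p a b F = F) (hF : ExpandsOn strip c F) {n : ℤ} (hn : n < 0) (r : ℤ) :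
    qzCoeff F n r = 0 := by
  refine (hasSum_qzCoeff hd hell hF n r).unique ?_
  convert! hasSum_zero using 2 with N
  rw [if_neg (by omega)]

/-- Elliptic invariance bounds the support of the Fourier coefficients. -/
lemma sq_le_of_coeff_ne_zero (hd : ∀ τ, Differentiable ℂ fun z => F (τ, z))
    (hell : ∀ a b, slashZ p a b F = F) (hF : ExpandsOn strip c F) {N : ℕ × ℤ} (hN : c N ≠ 0) :
    N.2 ^ 2 ≤ 4 * (N.1 : ℤ) * p + (p : ℤ) ^ 2 := by
  obtain ⟨n, r⟩ := N
  have key : ∀ l : ℤ, 0 ≤ n + (p * l ^ 2 + r * l) := fun l => by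
    by_contra! hlt
    have h1 := qzCoeff_add hd hell (n + (p * l ^ 2 + r * l)) r l
    rw [qzCoeff_of_neg hd hell hF hlt, add_sub_cancel_right, qzCoeff_natCast hd hell hF] at h1
    exact hN h1.symm
  dsimp only
  rcases Nat.eq_zero_or_pos p with rfl | hp
  · by_contra! hlt
    -- In index 0 this choice gives n − (n+1)r², which is negative as soon as r ≠ 0.
    have h1 := key (-(n + 1) * r)
    have h2 : 0 < r ^ 2 := by simpa using hlt
    simp only [Nat.cast_zero, zero_mul, zero_add] at h1
    nlinarith
  · have hp' : (0 : ℤ) < p := by exact_mod_cast hp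
    obtain ⟨l, hl1, hl2⟩ : ∃ l : ℤ, -p ≤ r + 2 * p * l ∧ r + 2 * p * l ≤ p := by
      -- This l reduces r modulo 2p to a representative in [−p, p].
      refine ⟨-((r + p) / (2 * p)), ?_, ?_⟩
      · have := Int.ediv_mul_le (r + p) (b := 2 * p) (by positivity)
        linarith
      · have := Int.lt_ediv_add_one_mul_self (r + p) (b := 2 * p) (by positivity)
        linarith
    -- The bound follows from 4p(n + pl² + rl) = 4pn + (r + 2pl)² − r².
    have h1 := key l
    have h2 : (r + 2 * p * l) ^ 2 ≤ (p : ℤ) ^ 2 := sq_le_sq' hl1 hl2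
    nlinarith

/-- The support condition makes |r| at most of order √n, so the growth of a mode in z costs only a
small multiple of n. Comparison with a point of the strip at height im τ/2 absorbs it. -/
lemma summable_of_support {c : ℕ × ℤ → ℂ} {p : ℕ}
    (hc : ∀ N : ℕ × ℤ, c N ≠ 0 → N.2 ^ 2 ≤ 4 * (N.1 : ℤ) * p + (p : ℤ) ^ 2)
    (hs : ∀ x : ℍ × ℂ, (x.1.im, x.2.im) ∈ strip → Summable fun N => c N * fourierMode N x)
    (x : ℍ × ℂ) : Summable fun N => c N * fourierMode N x := by
  obtain ⟨τ, z⟩ := x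
  set t := τ.im with ht
  have ht0 : 0 < t := τ.im_pos
  set τ' : ℍ := ⟨(t / 2 : ℝ) * I, by simpa using! ht0⟩ with hτ'
  have him : τ'.im = t / 2 := by simp [hτ', ← UpperHalfPlane.coe_im]
  have h0 := (hs (τ', (t / 4 : ℝ) * I) ⟨by simpa using ht0, by
    simp only [him]; simp; linarith⟩).norm
  set B : ℝ := |z.im| + t / 4 with hB
  set δ : ℝ := t / (8 * (p + 1)) with hδ
  have hδ0 : 0 < δ := by positivity
  have hδ1 : δ * (8 * (p + 1)) = t := by rw [hδ]; field_simp
  refine Summable.of_norm_bounded (h0.mul_left (Real.exp (2 * π * (δ * p ^ 2 + B ^ 2 / (4 * δ)))))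
    fun N => ?_
  by_cases hN : c N = 0
  · simp [hN]
  · have hr := hc N hN
    have hr' : (N.2 : ℝ) ^ 2 ≤ 4 * N.1 * p + p ^ 2 := by exact_mod_cast hr
    rw [norm_mul, norm_mul, mul_left_comm]
    refine mul_le_mul_of_nonneg_left ?_ (norm_nonneg _)
    rw [norm_fourierMode, norm_fourierMode, ← Real.exp_add]
    refine Real.exp_le_exp.mpr ?_
    have h1 : -(N.2 * (z.im - t / 4)) ≤ |(N.2 : ℝ)| * B := by
      refine (neg_le_abs _).trans ?_
      rw [abs_mul]
      refine mul_le_mul_of_nonneg_left ?_ (abs_nonneg _)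
      refine (abs_sub _ _).trans ?_
      rw [abs_of_pos (show 0 < t / 4 by positivity)]
    have h2 : |(N.2 : ℝ)| * B ≤ δ * (N.2 : ℝ) ^ 2 + B ^ 2 / (4 * δ) := by
      have h3 : δ * (N.2 : ℝ) ^ 2 + B ^ 2 / (4 * δ) - |(N.2 : ℝ)| * B =
          δ * (|(N.2 : ℝ)| - B / (2 * δ)) ^ 2 := by
        rw [← sq_abs (N.2 : ℝ)]
        field_simp
        ring
      have h4 : 0 ≤ δ * (|(N.2 : ℝ)| - B / (2 * δ)) ^ 2 := by positivity
      linarith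
    have h5 : δ * (N.2 : ℝ) ^ 2 ≤ N.1 * (t / 2) + δ * p ^ 2 := by
      have h6 := mul_le_mul_of_nonneg_left hr' hδ0.le
      have h7 : 0 ≤ (N.1 : ℝ) * δ := by positivity
      have h8 : (N.1 : ℝ) * (t / 2) = N.1 * δ * (4 * p) + N.1 * δ * 4 := by
        rw [← hδ1]; ring
      rw [h8]
      linarith
    have hπ := Real.pi_pos
    have him2 : ((t / 4 : ℝ) * I : ℂ).im = t / 4 := by simp
    simp only [him, him2, ← ht]
    have : -(N.1 * t + N.2 * z.im) ≤
        δ * p ^ 2 + B ^ 2 / (4 * δ) - (N.1 * (t / 2) + N.2 * (t / 4)) := by linarith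
    nlinarith

/-- A function that is entire in `z`, elliptic, and has a Fourier expansion in the strip
`0 < im z < im τ` is holomorphic and has the Fourier expansion of a weak Jacobi form. -/
theorem isHolo_and_hasWeakFourierExpansion (hd : ∀ τ, Differentiable ℂ fun z => F (τ, z))
    (hell : ∀ a b, slashZ p a b F = F) (hF : Expandable strip F) :
    IsHolo F ∧ HasWeakFourierExpansion p F := by
  obtain ⟨c, hc⟩ := hF
  have hsupp := fun N => sq_le_of_coeff_ne_zero hd hell hc (N := N)
  have hsum := summable_of_support hsupp fun x hx => (hc x hx).summable
  let G : ℍ × ℂ → ℂ := fun x => ∑' N, c N * fourierMode N x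
  have hG : ExpandsOn Set.univ c G := fun x _ => (hsum x).hasSum
  have hFG : F = G := by
    ext ⟨τ, z⟩
    have hop : IsOpen {w : ℂ | (τ.im, w.im) ∈ strip} :=
      isOpen_strip.preimage (Continuous.prodMk_right _ |>.comp Complex.continuous_im)
    have hm : (τ.im / 2 : ℝ) * I ∈ {w : ℂ | (τ.im, w.im) ∈ strip} := by
      have := τ.im_pos
      constructor <;> simpa
    refine congrFun (AnalyticOnNhd.eq_of_eventuallyEq (𝕜 := ℂ) (z₀ := (τ.im / 2 : ℝ) * I)
      (f := fun w => F (τ, w)) (g := fun w => G (τ, w))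
      ((hd τ).differentiableOn.analyticOnNhd isOpen_univ)
      ((hG.isHolo.differentiable_right τ).differentiableOn.analyticOnNhd isOpen_univ) ?_) z
    -- For fixed τ the strip is a nonempty open set of z, so the identity theorem propagates the
    -- equality to ℂ.
    filter_upwards [hop.mem_nhds hm] with w hw
    exact (hc (τ, w) hw).unique (hsum _).hasSum
  subst hFG
  exact ⟨hG.isHolo, c, hsupp, fun x => hG x trivial⟩

end

end

end WeakJacobi

namespace WeakJacobi

noncomputable section

/-! ### The lattice and the zeta function -/

lemma mem_latt {τ : ℍ} {w : ℂ} : w ∈ latt τ ↔ ∃ m n : ℤ, (m : ℂ) + n * (τ : ℂ) = w := by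
  simp [latt, PeriodPair.mem_lattice, periods]

lemma denom_eq (γ : SL(2, ℤ)) (τ : ℍ) : denom γ τ = γ 1 0 * τ + γ 1 1 :=
  ModularGroup.denom_apply γ τ

lemma coe_smul_eq (γ : SL(2, ℤ)) (τ : ℍ) :
    ((γ • τ : ℍ) : ℂ) = (γ 0 0 * τ + γ 0 1) / denom γ τ := by
  rw [coe_specialLinearGroup_apply, denom_eq]
  simp

lemma denom_ne_zero' (γ : SL(2, ℤ)) (τ : ℍ) : denom γ τ ≠ 0 := denom_ne_zero γ τ

lemma mem_latt_smul (γ : SL(2, ℤ)) (τ : ℍ) (w : ℂ) :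
    w ∈ latt (γ • τ) ↔ w * denom γ τ ∈ latt τ := by
  have hd := denom_ne_zero' γ τ
  have hdet : (γ 0 0 : ℂ) * γ 1 1 - γ 0 1 * γ 1 0 = 1 := by
    have := γ.det_coe
    rw [Matrix.det_fin_two] at this
    exact_mod_cast this
  simp only [mem_latt, coe_smul_eq]
  constructor
  · rintro ⟨m, n, rfl⟩
    refine ⟨m * γ 1 1 + n * γ 0 1, m * γ 1 0 + n * γ 0 0, ?_⟩
    field_simp
    rw [denom_eq]
    push_cast
    ring
  · rintro ⟨m, n, h⟩
    -- The coordinates come from the inverse matrix.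
    refine ⟨γ 0 0 * m - γ 0 1 * n, γ 1 1 * n - γ 1 0 * m, ?_⟩
    rw [← mul_left_inj' hd, ← h]
    field_simp
    rw [denom_eq]
    push_cast
    linear_combination (m + n * (τ : ℂ)) * hdet

lemma isClosed_latt (τ : ℍ) : IsClosed (latt τ : Set ℂ) := (periods τ).isClosed_lattice

lemma eventually_notMem_latt (τ : ℍ) (z : ℂ) : ∀ᶠ w in 𝓝[≠] z, w ∉ latt τ := by
  rw [eventually_nhdsWithin_iff]
  filter_upwards [(periods τ).compl_lattice_sdiff_singleton_mem_nhds z] with w hw hne h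
  exact hw ⟨h, hne⟩

/-- The regular part at the origin of the Weierstrass zeta function. -/
def zetaReg (τ : ℍ) (z : ℂ) : ℂ :=
  ∑' l : (periods τ).lattice, if (l : ℂ) = 0 then 0 else (1 / (z - l) + 1 / l + z / (l : ℂ) ^ 2)

/-- The three terms combine to s²/(l²(s − l)), which decays cubically in l; this gives local uniform
convergence. -/
lemma zeta_bound {r : ℝ} (hr : 0 < r) {s : ℂ} (hs : ‖s‖ < r) {l : ℂ} (h : 2 * r ≤ ‖l‖) :
    ‖1 / (s - l) + 1 / l + s / l ^ 2‖ ≤ 2 * r ^ 2 * ‖l‖ ^ (-3 : ℝ) := by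
  have hl : 0 < ‖l‖ := by linarith
  have hl0 : l ≠ 0 := norm_pos_iff.mp hl
  have hsl : ‖l‖ / 2 ≤ ‖s - l‖ := by
    have := norm_sub_norm_le l s
    rw [norm_sub_rev] at this
    linarith
  have hsl0 : s - l ≠ 0 := norm_pos_iff.mp (by linarith)
  have h1 : 1 / (s - l) + 1 / l + s / l ^ 2 = s ^ 2 / (l ^ 2 * (s - l)) := by
    field_simp
    ring
  rw [h1, norm_div, norm_mul, norm_pow, norm_pow, Real.rpow_neg hl.le]
  have h3 : ‖l‖ ^ (3 : ℝ) = ‖l‖ ^ 3 := by exact_mod_cast Real.rpow_natCast ‖l‖ 3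
  rw [h3]
  calc ‖s‖ ^ 2 / (‖l‖ ^ 2 * ‖s - l‖) ≤ r ^ 2 / (‖l‖ ^ 2 * (‖l‖ / 2)) := by gcongr
    _ = _ := by field_simp

lemma hasSumLocallyUniformly_zetaReg (τ : ℍ) :
    HasSumLocallyUniformly (fun (l : (periods τ).lattice) (z : ℂ) =>
      if (l : ℂ) = 0 then 0 else (1 / (z - l) + 1 / l + z / (l : ℂ) ^ 2)) (zetaReg τ) := by
  refine (periods τ).hasSumLocallyUniformly_aux (u := (2 * · ^ 2 * ‖·‖ ^ (-3 : ℝ))) _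
    (fun _ _ => (ZLattice.summable_norm_rpow _ _ (by simp; norm_num)).mul_left _) fun r hr =>
    Filter.eventually_atTop.mpr ⟨2 * r, ?_⟩
  rintro _ h s hs l rfl
  split_ifs
  · rw [norm_zero]; positivity
  · exact zeta_bound hr hs h

lemma hasSum_zetaReg (τ : ℍ) (z : ℂ) :
    HasSum (fun l : (periods τ).lattice =>
      if (l : ℂ) = 0 then 0 else (1 / (z - l) + 1 / l + z / (l : ℂ) ^ 2)) (zetaReg τ z) :=
  (hasSumLocallyUniformly_zetaReg τ).hasSum

lemma differentiableOn_zetaReg (τ : ℍ) :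
    DifferentiableOn ℂ (zetaReg τ) ((latt τ : Set ℂ) \ {0})ᶜ := by
  refine (hasSumLocallyUniformly_zetaReg τ).hasSumLocallyUniformlyOn.differentiableOn
    (.of_forall fun s => .fun_sum fun i hi => ?_) (periods τ).isOpen_compl_lattice_sdiff
  split_ifs with h
  · simp
  · refine .add (.add (.div (by fun_prop) (by fun_prop) fun x hx h0 => hx ?_) (by fun_prop))
      (by fun_prop)
    rw [sub_eq_zero.mp h0]
    exact ⟨i.2, h⟩

@[simp] lemma zetaReg_zero (τ : ℍ) : zetaReg τ 0 = 0 := by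
  refine (tsum_congr fun l => ?_).trans tsum_zero
  split_ifs
  · rfl
  · simp

/-- With 1/0 = 0 the term at l = 0 is exactly 1/z, so ζ is a sum over the whole lattice and can be
reindexed by lattice bijections. -/
lemma hasSum_zetaReg' (τ : ℍ) (z : ℂ) :
    HasSum (fun l : (periods τ).lattice => 1 / (z - l) + 1 / (l : ℂ) + z / (l : ℂ) ^ 2)
      (1 / z + zetaReg τ z) := by
  have h1 := hasSum_ite_eq (0 : (periods τ).lattice) (1 / z)
  refine (h1.add (hasSum_zetaReg τ z)).congr_fun fun l => ?_
  by_cases h : l = 0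
  · simp [h]
  · have : (l : ℂ) ≠ 0 := by simpa using h
    simp [h, this]

lemma zeta_eq (τ : ℍ) (z : ℂ) : zeta τ z = 1 / z + zetaReg τ z := by
  have h1 := hasSum_zetaReg τ z
  rw [← hasSum_subtype_iff_of_support_subset (s := {w : (periods τ).lattice | w ≠ 0})] at h1
  · rw [zeta, ← h1.tsum_eq]
    congr 1
    refine tsum_congr fun w => ?_
    have : ((w.1 : latt τ) : ℂ) ≠ 0 := by simpa using w.2
    exact (if_neg this).symm
  · intro w hw h
    simp [h] at hw

lemma hasSum_zeta (τ : ℍ) (z : ℂ) :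
    HasSum (fun l : latt τ => 1 / (z - l) + 1 / (l : ℂ) + z / (l : ℂ) ^ 2) (zeta τ z) := by
  rw [zeta_eq]
  exact hasSum_zetaReg' τ z

/-- Homogeneity of degree −1: multiplication by cτ+d maps one lattice onto the other. -/
lemma zeta_smul (γ : SL(2, ℤ)) (τ : ℍ) (z : ℂ) :
    zeta (γ • τ) (z / denom γ τ) = denom γ τ * zeta τ z := by
  have hd := denom_ne_zero' γ τ
  let e : latt (γ • τ) ≃ latt τ := (Equiv.mulRight₀ _ hd).subtypeEquiv fun w => mem_latt_smul γ τ w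
  refine (hasSum_zeta (γ • τ) (z / denom γ τ)).unique ?_
  have h1 := (hasSum_zeta τ z).mul_left (denom γ τ)
  rw [← e.hasSum_iff] at h1
  refine h1.congr_fun fun w => ?_
  have he : ((e w : latt τ) : ℂ) = w * denom γ τ := rfl
  have h2 : z / denom γ τ - w = (z - w * denom γ τ) / denom γ τ := by field_simp
  simp only [Function.comp, he]
  rw [h2, one_div_div, mul_pow]
  rcases eq_or_ne (w : ℂ) 0 with h0 | h0
  · simp [h0, div_eq_mul_inv]
  · field_simp

/-! ### Summation in the Eisenstein order -/

open SummationFilter EisensteinSeries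

lemma sum_Icc_neg_eq {α : Type*} [AddCommGroup α] (f : ℤ → α) (N : ℕ) :
    ∑ n ∈ Finset.Icc (-N : ℤ) N, f n =
      f 0 + ∑ j ∈ Finset.range N, (f (j + 1) + f (-(j + 1))) := by
  induction N with
  | zero => simp
  | succ N ih =>
    have h : Finset.Icc (-(N + 1 : ℕ) : ℤ) (N + 1 : ℕ) =
        insert (-(N + 1) : ℤ) (insert ((N : ℤ) + 1) (Finset.Icc (-N : ℤ) N)) := by
      ext x
      simp only [Finset.mem_Icc, Finset.mem_insert]
      omega
    rw [h, Finset.sum_insert (by simp; omega), Finset.sum_insert (by simp), ih,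
      Finset.sum_range_succ]
    abel

lemma hasSum_symmetricIcc {f : ℤ → ℂ} {a : ℂ} (h : HasSum f a) : HasSum f a (symmetricIcc ℤ) :=
  Tendsto.mono_left h (symmetricIcc ℤ).le_atTop

lemma hasSum_symmetricIcc_of_odd {f : ℤ → ℂ} (hf : ∀ n, f (-n) = -f n) :
    HasSum f 0 (symmetricIcc ℤ) := by
  have h0 : f 0 = 0 := by simpa [self_eq_neg] using hf 0
  rw [hasSum_symmetricIcc_iff]
  refine tendsto_const_nhds.congr fun N => ?_
  rw [sum_Icc_neg_eq, h0]
  simp only [hf, add_neg_cancel, Finset.sum_const_zero, add_zero]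

lemma hasSum_cot {u : ℂ} (hu : u ∈ integerComplement) :
    HasSum (fun n : ℤ => 1 / (u + n)) (π * cot (π * u)) (symmetricIcc ℤ) := by
  rw [hasSum_symmetricIcc_iff]
  have h := (tendsto_logDeriv_euler_cot_sub hu).const_add (1 / u)
  rw [add_sub_cancel] at h
  refine h.congr fun N => ?_
  rw [sum_Icc_neg_eq]
  congr 1
  · simp
  · refine Finset.sum_congr rfl fun j _ => ?_
    rw [cotTerm, add_comm]
    push_cast
    rw [sub_eq_add_neg]

/-- The value u = 0 is needed for the row m = 0. There both sides vanish, since 1/0 = 0 makes the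
summand odd and cot 0 equal to 0. -/
lemma hasSum_cot' {u : ℂ} (hu : u ∈ integerComplement ∨ u = 0) :
    HasSum (fun n : ℤ => 1 / (u + n)) (π * cot (π * u)) (symmetricIcc ℤ) := by
  rcases hu with hu | rfl
  · exact hasSum_cot hu
  · have : π * cot (π * 0) = 0 := by simp [Complex.cot]
    rw [this]
    exact hasSum_symmetricIcc_of_odd fun n => by simp [div_neg]

lemma cot_neg_mul (u : ℂ) : cot (π * (-u)) = -cot (π * u) := by
  simp [Complex.cot, div_neg]

lemma cot_pi_add_int (u : ℂ) (n : ℤ) : cot (π * (u + n)) = cot (π * u) := by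
  rw [Complex.cot_pi_eq_exp_ratio, Complex.cot_pi_eq_exp_ratio]
  have : cexp (2 * π * I * (u + n)) = cexp (2 * π * I * u) := by
    rw [mul_add, Complex.exp_add, mul_comm _ (n : ℂ), Complex.exp_int_mul_two_pi_mul_I, mul_one]
  rw [this]

/-- The zeta function as a cotangent series, summed in the Eisenstein order. -/
lemma hasSum_cot_zeta {τ : ℍ} {z : ℂ} (hz : z ∉ latt τ) :
    HasSum (fun m : ℤ => π * cot (π * (z - m * τ))) (zeta τ z - z * G2 τ) (symmetricIcc ℤ) := by
  let e : ℤ × ℤ ≃ latt τ := (Equiv.prodComm ℤ ℤ).trans (periods τ).latticeEquivProd.symm.toEquiv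
  have he : ∀ m n : ℤ, ((e (m, n) : latt τ) : ℂ) = n + m * τ := fun m n => by
    have := (periods τ).latticeEquiv_symm_apply (n, m)
    simpa [periods] using! this
  have h1 := hasSum_zeta τ z
  rw [← e.hasSum_iff] at h1
  -- A row converges absolutely, but its 1/(z − l) and 1/l parts separately converge only in
  -- symmetric order. The row is split there, and uniqueness of symmetric sums identifies its value.
  have hfib : ∀ m : ℤ, HasSum (fun n : ℤ => 1 / (z - (n + m * τ)) + 1 / (n + m * (τ : ℂ)) +
      z / (n + m * (τ : ℂ)) ^ 2)
      (π * cot (π * (z - m * τ)) + π * cot (π * (m * τ)) + z * e2Summand m τ) := fun m => by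
    have hs : Summable (fun n : ℤ => 1 / (z - (n + m * τ)) + 1 / (n + m * (τ : ℂ)) +
        z / (n + m * (τ : ℂ)) ^ 2) := by
      have := h1.summable.prod_factor m
      simpa only [Function.comp, he] using this
    have hs1 := hs.hasSum
    have e1 : (m : ℂ) * τ - z ∈ integerComplement := by
      rintro ⟨n, hn⟩
      exact hz (mem_latt.mpr ⟨-n, m, by push_cast; rw [hn]; ring⟩)
    have e2 : (m * τ : ℂ) ∈ integerComplement ∨ (m * τ : ℂ) = 0 := by
      rcases eq_or_ne m 0 with rfl | hm
      · right; simp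
      · left
        rintro ⟨n, hn⟩
        have := congrArg Complex.im hn
        simp [hm, τ.im_ne_zero] at this
    have t1 := (hasSum_cot e1).neg
    rw [← neg_sub z, cot_neg_mul, mul_neg, neg_neg] at t1
    have t2 := hasSum_cot' e2
    have t3 : HasSum (fun n : ℤ => z * eisSummand 2 ![m, n] τ) (z * e2Summand m τ)
        (symmetricIcc ℤ) :=
      hasSum_symmetricIcc ((e2Summand_summable m τ).hasSum.mul_left z)
    have t4 := (t1.add t2).add t3
    rw [← (hasSum_symmetricIcc hs1).unique (t4.congr_fun fun n => ?_)]
    · exact hs1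
    · have h2 : eisSummand 2 ![m, n] τ = ((n + m * (τ : ℂ)) ^ 2)⁻¹ := by
        rw [eisSummand, zpow_neg, zpow_ofNat]
        simp [add_comm]
      rw [h2, ← div_neg, ← div_eq_mul_inv, add_comm (m * (τ : ℂ)) n]
      congr 3
      ring
  have h2 := (h1.prod_fiberwise (g := fun m : ℤ => π * cot (π * (z - m * τ)) +
    π * cot (π * (m * τ)) + z * e2Summand m τ) fun m => by
      simpa only [Function.comp, he] using hfib m)
  have h3 := hasSum_symmetricIcc h2
  -- The terms cot(πmτ) are odd in m and disappear in symmetric order.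
  have h4 : HasSum (fun m : ℤ => π * cot (π * (m * τ))) 0 (symmetricIcc ℤ) :=
    hasSum_symmetricIcc_of_odd fun m => by
      rw [Int.cast_neg, neg_mul, cot_neg_mul, mul_neg]
  have h5 : HasSum (fun m => z * e2Summand m τ) (z * G2 τ) (symmetricIcc ℤ) :=
    (summable_e2Summand_symmetricIcc τ).hasSum.mul_left z
  have h6 := (h3.sub h4).sub h5
  rw [sub_zero] at h6
  refine h6.congr_fun fun m => ?_
  ring

end

end WeakJacobi

namespace WeakJacobi

noncomputable section

/-! ### Transformation laws of `J₁` -/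

open SummationFilter EisensteinSeries

lemma E2_eq_mul_G2 (τ : ℍ) : E2 τ = 3 / π ^ 2 * G2 τ := by
  have : (π : ℂ) ≠ 0 := by exact_mod_cast Real.pi_ne_zero
  simp only [E2, Pi.smul_apply, riemannZeta_two, smul_eq_mul]
  field_simp
  ring

/-- Since E₂ = (3/π²)G₂, the correction term in `J₁` removes precisely the G₂ left by the cotangent
series: 2πi·J₁ is the sum of π cot(π(z − mτ)). -/
lemma J₁_eq (τ : ℍ) (z : ℂ) : J₁ (τ, z) = (2 * π * I)⁻¹ * (zeta τ z - z * G2 τ) := by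
  have : (π : ℂ) ≠ 0 := by exact_mod_cast Real.pi_ne_zero
  have hI : I ≠ 0 := Complex.I_ne_zero
  simp only [J₁, E2_eq_mul_G2]
  field_simp
  linear_combination (6 * z * G2 τ) * Complex.I_sq

lemma E2_smul (γ : SL(2, ℤ)) (τ : ℍ) :
    E2 (γ • τ) = denom γ τ ^ 2 * E2 τ + 12 * (2 * π * I)⁻¹ * γ 1 0 * denom γ τ := by
  have h := congrFun (E2_slash_action γ) τ
  have hd := denom_ne_zero' γ τ
  have : (π : ℂ) ≠ 0 := by exact_mod_cast Real.pi_ne_zero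
  have hI : I ≠ 0 := Complex.I_ne_zero
  rw [ModularForm.SL_slash_apply] at h
  simp only [Pi.sub_apply, Pi.smul_apply, D2, smul_eq_mul, riemannZeta_two] at h
  rw [zpow_neg, ← div_eq_mul_inv, div_eq_iff (zpow_ne_zero _ hd)] at h
  rw [h, zpow_ofNat]
  field_simp
  linear_combination (-(12 : ℂ) * γ 1 0) * Complex.I_sq

/-- The anomaly cz is the inhomogeneous term of E₂ multiplied by z. -/
lemma J₁_smul (γ : SL(2, ℤ)) (τ : ℍ) (z : ℂ) :
    J₁ (γ • τ, z / denom γ τ) = denom γ τ * J₁ (τ, z) + γ 1 0 * z := by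
  have hd := denom_ne_zero' γ τ
  have : (π : ℂ) ≠ 0 := by exact_mod_cast Real.pi_ne_zero
  have hI : I ≠ 0 := Complex.I_ne_zero
  simp only [J₁, zeta_smul, E2_smul]
  field_simp
  ring

lemma J₁_add_int {τ : ℍ} {z : ℂ} (hz : z ∉ latt τ) (n : ℤ) : J₁ (τ, z + n) = J₁ (τ, z) := by
  have hz' : z + n ∉ latt τ := fun h => hz <| by
    have h1 : (n : ℂ) ∈ latt τ := mem_latt.mpr ⟨n, 0, by simp⟩
    simpa using sub_mem h h1
  have h1 := hasSum_cot_zeta hz'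
  have h2 := hasSum_cot_zeta hz
  have h3 : ∀ m : ℤ, cot (π * (z + n - m * τ)) = cot (π * (z - m * τ)) := fun m => by
    rw [← cot_pi_add_int (z - m * τ) n]
    congr 2
    ring
  simp only [h3] at h1
  rw [J₁_eq, J₁_eq, h1.unique h2]

/-- The inversion S turns translation by aτ into translation by the integer a, under which `J₁` is
invariant. The difference of the anomalies at z and z + aτ produces −a. -/
lemma J₁_add {τ : ℍ} {z : ℂ} (hz : z ∉ latt τ) (a b : ℤ) :
    J₁ (τ, z + a * τ + b) = J₁ (τ, z) - a := by
  have hz' : z + a * τ ∉ latt τ := fun h => hz <| by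
    have h1 : (a * τ : ℂ) ∈ latt τ := mem_latt.mpr ⟨0, a, by simp⟩
    simpa using sub_mem h h1
  rw [J₁_add_int hz']
  have hd : denom ModularGroup.S τ = τ := by
    rw [denom_eq]
    simp [ModularGroup.S]
  have hτ : (τ : ℂ) ≠ 0 := τ.ne_zero
  have h1 := J₁_smul ModularGroup.S τ z
  have h2 := J₁_smul ModularGroup.S τ (z + a * τ)
  rw [hd] at h1 h2
  have hS : ((ModularGroup.S 1 0 : ℤ) : ℂ) = 1 := by simp [ModularGroup.S]
  have h3 : (z + a * τ) / (τ : ℂ) = z / τ + a := by field_simp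
  rw [h3, J₁_add_int, h1, hS] at h2
  · rw [← mul_right_inj' hτ]
    linear_combination -h2
  · rw [mem_latt_smul, hd, div_mul_cancel₀ _ hτ]
    exact hz

/-! ### Regularity of `J₁` in the second variable -/

/-- The regular part of `J₁` at `z = 0`. -/
def J₁Reg (τ : ℍ) (z : ℂ) : ℂ := (2 * π * I)⁻¹ * zetaReg τ z + π * I / 6 * z * E2 τ

lemma J₁_eq_add (τ : ℍ) (z : ℂ) : J₁ (τ, z) = (2 * π * I)⁻¹ * (1 / z) + J₁Reg τ z := by
  simp only [J₁, J₁Reg, zeta_eq]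
  ring

@[simp] lemma J₁Reg_zero (τ : ℍ) : J₁Reg τ 0 = 0 := by simp [J₁Reg]

lemma differentiableOn_J₁Reg (τ : ℍ) :
    DifferentiableOn ℂ (J₁Reg τ) ((latt τ : Set ℂ) \ {0})ᶜ :=
  ((differentiableOn_zetaReg τ).const_mul _).add (by fun_prop)

lemma isOpen_compl_latt_sdiff (τ : ℍ) : IsOpen ((latt τ : Set ℂ) \ {0})ᶜ :=
  (periods τ).isOpen_compl_lattice_sdiff

lemma differentiableAt_J₁ {τ : ℍ} {z : ℂ} (hz : z ∉ latt τ) :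
    DifferentiableAt ℂ (fun w => J₁ (τ, w)) z := by
  have hz0 : z ≠ 0 := by rintro rfl; exact hz (zero_mem _)
  simp only [J₁_eq_add]
  refine DifferentiableAt.add (.const_mul (.div (by fun_prop) (by fun_prop) hz0) _) ?_
  exact (differentiableOn_J₁Reg τ).differentiableAt
    ((isOpen_compl_latt_sdiff τ).mem_nhds fun h => hz h.1)

/-! ### The Fourier expansion of `J₁` in the strip -/

lemma pi_mul_cot_of_im_pos {u : ℂ} (hu : 0 < u.im) :
    π * cot (π * u) = -(π * I) - 2 * π * I * ∑' r : ℕ, cexp (2 * π * I * u) ^ (r + 1) := by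
  have h := pi_mul_cot_pi_q_exp ⟨u, hu⟩
  have hs : Summable fun r : ℕ => cexp (2 * π * I * u) ^ r :=
    summable_geometric_of_norm_lt_one (norm_exp_two_pi_I_lt_one ⟨u, hu⟩)
  simp only [hs.tsum_eq_zero_add] at h
  rw [h]
  ring

lemma summable_geometric_prod {a b : ℂ} (ha : ‖a‖ < 1) (hb : ‖b‖ < 1) :
    Summable fun x : ℕ × ℕ => (a * b ^ x.1) ^ (x.2 + 1) := by
  have h1 := (summable_geometric_of_lt_one (norm_nonneg b) hb).mul_of_nonneg
    (summable_geometric_of_lt_one (norm_nonneg a) ha) (fun _ => by positivity)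
    (fun _ => by positivity)
  refine Summable.of_norm_bounded h1 fun x => ?_
  rw [norm_pow, norm_mul, norm_pow, mul_pow, mul_comm]
  have h2 : ‖a‖ ^ (x.2 + 1) ≤ ‖a‖ ^ x.2 := pow_le_pow_of_le_one (norm_nonneg _) ha.le (by omega)
  have h3 : (‖b‖ ^ x.1) ^ (x.2 + 1) ≤ ‖b‖ ^ x.1 :=
    pow_le_of_le_one (by positivity) (pow_le_one₀ (norm_nonneg _) hb.le) (by omega)
  exact mul_le_mul h3 h2 (by positivity) (by positivity)

lemma fourierMode_pow (N : ℕ × ℤ) (x : ℍ × ℂ) (r : ℕ) :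
    fourierMode N x ^ r = fourierMode (r • N) x := by
  rw [fourierMode, fourierMode, ← Complex.exp_nat_mul]
  congr 1
  simp
  ring

lemma norm_cexp_lt_one {u : ℂ} (hu : 0 < u.im) : ‖cexp (2 * π * I * u)‖ < 1 :=
  norm_exp_two_pi_I_lt_one ⟨u, hu⟩

lemma notMem_latt_of_mem_strip {τ : ℍ} {z : ℂ} (hx : (τ.im, z.im) ∈ strip) : z ∉ latt τ := by
  obtain ⟨h0, h1⟩ := hx
  rw [mem_latt]
  rintro ⟨m, n, rfl⟩
  simp at h0 h1
  have hn : 0 < n := by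
    by_contra! hn
    have : (n : ℝ) ≤ 0 := by exact_mod_cast hn
    nlinarith [τ.im_pos]
  have : (1 : ℝ) ≤ n := by exact_mod_cast hn
  nlinarith [τ.im_pos]

/-- `J₁` as a sum of geometric series in the strip `0 < im z < im τ`. -/
lemma J₁_eq_geometric {τ : ℍ} {z : ℂ} (hx : (τ.im, z.im) ∈ strip) :
    J₁ (τ, z) = -(1 / 2) - ∑' r : ℕ, fourierMode (0, 1) (τ, z) ^ (r + 1) -
      ∑' x : ℕ × ℕ, (fourierMode (1, 1) (τ, z) * fourierMode (1, 0) (τ, z) ^ x.1) ^ (x.2 + 1) +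
      ∑' x : ℕ × ℕ, (fourierMode (1, -1) (τ, z) * fourierMode (1, 0) (τ, z) ^ x.1) ^ (x.2 + 1) := by
  obtain ⟨h0, h1⟩ := hx
  simp only at h0 h1
  have hz := notMem_latt_of_mem_strip ⟨h0, h1⟩
  have hm : ∀ N : ℕ × ℤ, fourierMode N (τ, z) = cexp (2 * π * I * ((N.1 : ℂ) * τ + N.2 * z)) :=
    fun N => rfl
  have n1 : ‖fourierMode (1, 0) (τ, z)‖ < 1 := norm_cexp_lt_one (by simpa using τ.im_pos)
  have n2 : ‖fourierMode (1, 1) (τ, z)‖ < 1 :=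
    norm_cexp_lt_one (by simp; linarith [τ.im_pos])
  have n3 : ‖fourierMode (1, -1) (τ, z)‖ < 1 := norm_cexp_lt_one (by simp; linarith [τ.im_pos])
  have s2 := summable_geometric_prod n2 n1
  have s3 := summable_geometric_prod n3 n1
  have t2 := (s2.hasSum.prod_fiberwise fun m => (s2.prod_factor m).hasSum).tendsto_sum_nat
  have t3 := (s3.hasSum.prod_fiberwise fun m => (s3.prod_factor m).hasSum).tendsto_sum_nat
  have t4 := ((t3.sub t2).const_mul (2 * π * I)).const_add
    (-(π * I) - 2 * π * I * ∑' r : ℕ, fourierMode (0, 1) (τ, z) ^ (r + 1))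
  have t5 := hasSum_symmetricIcc_iff.mp (hasSum_cot_zeta hz)
  have key := tendsto_nhds_unique (t4.congr fun N => ?_) t5
  · rw [J₁_eq, ← key]
    have : (2 * π * I : ℂ) ≠ 0 := by simp [Real.pi_ne_zero]
    have hI : I ≠ 0 := Complex.I_ne_zero
    have hπ : (π : ℂ) ≠ 0 := by exact_mod_cast Real.pi_ne_zero
    field_simp
    ring
  · rw [sum_Icc_neg_eq]
    congr 1
    · rw [Int.cast_zero, zero_mul, sub_zero, pi_mul_cot_of_im_pos h0]
      simp [hm]
    · rw [← Finset.sum_sub_distrib, Finset.mul_sum]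
      refine Finset.sum_congr rfl fun j _ => ?_
      -- In the strip both z + (j+1)τ and (j+1)τ − z lie in ℍ. The cotangents at ±(j+1) therefore
      -- expand geometrically, and their constants cancel.
      have i1 : 0 < (z + ((j : ℂ) + 1) * τ).im := by
        simp
        nlinarith [τ.im_pos, (Nat.cast_nonneg j : (0 : ℝ) ≤ j)]
      have i2 : 0 < (((j : ℂ) + 1) * τ - z).im := by
        simp
        nlinarith [τ.im_pos, (Nat.cast_nonneg j : (0 : ℝ) ≤ j)]
      have c1 : z - ((-((j : ℤ) + 1) : ℤ) : ℂ) * τ = z + ((j : ℂ) + 1) * τ := by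
        push_cast; ring
      have c2 : z - (((j : ℤ) + 1 : ℤ) : ℂ) * τ = -(((j : ℂ) + 1) * τ - z) := by
        push_cast; ring
      have e1 : cexp (2 * π * I * (z + ((j : ℂ) + 1) * τ)) =
          fourierMode (1, 1) (τ, z) * fourierMode (1, 0) (τ, z) ^ j := by
        rw [fourierMode_pow, ← fourierMode_add, hm]
        congr 1
        simp
        ring
      have e2 : cexp (2 * π * I * (((j : ℂ) + 1) * τ - z)) =
          fourierMode (1, -1) (τ, z) * fourierMode (1, 0) (τ, z) ^ j := by
        rw [fourierMode_pow, ← fourierMode_add, hm]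
        congr 1
        simp
        ring
      rw [c1, c2, cot_neg_mul, mul_neg, pi_mul_cot_of_im_pos i1, pi_mul_cot_of_im_pos i2, e1, e2]
      ring

/-! ### Closure properties of expandability, and the expansions of E₂ and `J₁` -/

namespace Expandable

variable {V W : Set (ℝ × ℝ)} {F G : ℍ × ℂ → ℂ}

lemma congr (hF : Expandable V F) (h : ∀ x : ℍ × ℂ, (x.1.im, x.2.im) ∈ V → F x = G x) :
    Expandable V G := by
  obtain ⟨c, hc⟩ := hF
  exact ⟨c, fun x hx => h x hx ▸ hc x hx⟩

lemma mono (hF : Expandable V F) (h : W ⊆ V) : Expandable W F := by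
  obtain ⟨c, hc⟩ := hF
  exact ⟨c, hc.mono h⟩

lemma add (hF : Expandable V F) (hG : Expandable V G) : Expandable V (F + G) := by
  obtain ⟨c, hc⟩ := hF
  obtain ⟨d, hd⟩ := hG
  exact ⟨_, hc.add hd⟩

lemma const_smul (hF : Expandable V F) (s : ℂ) : Expandable V (s • F) := by
  obtain ⟨c, hc⟩ := hF
  exact ⟨_, hc.const_smul s⟩

lemma sub (hF : Expandable V F) (hG : Expandable V G) : Expandable V (F - G) := by
  have := hF.add (hG.const_smul (-1))
  rwa [neg_one_smul, ← sub_eq_add_neg] at this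

lemma mul (hF : Expandable V F) (hG : Expandable V G) : Expandable V (F * G) := by
  obtain ⟨c, hc⟩ := hF
  obtain ⟨d, hd⟩ := hG
  exact hc.mul hd

lemma dz (hF : Expandable V F) (hV : IsOpen V) : Expandable V (Dz F) := by
  obtain ⟨c, hc⟩ := hF
  exact ⟨_, hc.dz hV⟩

lemma dτ (hF : Expandable V F) (hV : IsOpen V) : Expandable V (Dτ F) := by
  obtain ⟨c, hc⟩ := hF
  exact ⟨_, hc.dτ hV⟩

lemma const (s : ℂ) : Expandable V fun _ => s :=
  .of_hasSum (fun _ : Unit => 0) (fun _ => s) fun x _ => by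
    simp [fourierMode]

lemma E2 : Expandable V fun x => EisensteinSeries.E2 x.1 :=
  .of_hasSum (fun n : ℕ => (n, 0))
    (fun m => if m = 0 then 1 else -24 * (ArithmeticFunction.sigma 1 m : ℂ)) fun x _ => by
    refine (hasSum_qExpansion_E2 x.1).congr_fun fun n => ?_
    rw [smul_eq_mul, ← Complex.exp_nat_mul, fourierMode]
    congr 2
    simp
    ring

lemma J₁ : Expandable strip J₁ := by
  have hm : ∀ (M N : ℕ × ℤ) (x : ℍ × ℂ) (i j : ℕ),
      (fourierMode M x * fourierMode N x ^ i) ^ (j + 1) =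
      1 * fourierMode ((j + 1) • (M + i • N)) x := fun M N x i j => by
    rw [one_mul, fourierMode_pow, ← fourierMode_add, fourierMode_pow]
  have h1 : Expandable strip fun x => ∑' r : ℕ, fourierMode (0, 1) x ^ (r + 1) :=
    .of_hasSum (fun r => (r + 1) • ((0, 1) : ℕ × ℤ)) (fun _ => 1) fun x hx => by
      simp only [fourierMode_pow, one_mul]
      simp only [← fourierMode_pow]
      refine (Summable.hasSum ?_)
      refine (summable_nat_add_iff 1).mpr (summable_geometric_of_norm_lt_one
        (norm_cexp_lt_one ?_))
      simpa using hx.1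
  have h2 : ∀ s : ℤ, |s| ≤ 1 → Expandable strip fun x => ∑' y : ℕ × ℕ,
      (fourierMode (1, s) x * fourierMode (1, 0) x ^ y.1) ^ (y.2 + 1) := fun s hs =>
    .of_hasSum (fun y : ℕ × ℕ => (y.2 + 1) • (((1, s) : ℕ × ℤ) + y.1 • ((1, 0) : ℕ × ℤ)))
      (fun _ => 1) fun x hx => by
        simp only [← hm]
        refine (summable_geometric_prod (norm_cexp_lt_one ?_) (norm_cexp_lt_one ?_)).hasSum
        · obtain ⟨h3, h4⟩ := hx
          obtain ⟨h5, h6⟩ := abs_le.mp hs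
          have h7 : (-1 : ℝ) ≤ s := by exact_mod_cast h5
          simp at h3 h4 ⊢
          nlinarith
        · simpa using x.1.im_pos
  refine ((((const (-(1 / 2))).sub h1).sub (h2 1 (by simp))).add (h2 (-1) (by simp))).congr
    fun x hx => ?_
  rw [show x = (x.1, x.2) from rfl, J₁_eq_geometric hx]
  rfl

end Expandable

end

end WeakJacobi

namespace WeakJacobi

noncomputable section

/-! ### Derivatives of functions on `ℍ × ℂ` -/

lemma isOpen_upperHalf_prod : IsOpen {x : ℂ × ℂ | 0 < x.1.im} :=
  isOpen_lt continuous_const (Complex.continuous_im.comp continuous_fst)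

/-- The chain rule for holomorphic functions on `ℍ × ℂ`. -/
lemma IsHolo.hasDerivAt_comp {f : ℍ × ℂ → ℂ} (hf : IsHolo f) {A B : ℂ → ℂ} {t A' B' : ℂ} {τ : ℍ}
    {z : ℂ} (hA : HasDerivAt A A' t) (hB : HasDerivAt B B' t) (hτ : A t = τ) (hz : B t = z) :
    HasDerivAt (fun s => f (ofComplex (A s), B s))
      (2 * π * I * (A' * Dτ f (τ, z) + B' * Dz f (τ, z))) t := by
  have h0 := ((hf ((τ : ℂ), z) τ.im_pos).differentiableAt
    (isOpen_upperHalf_prod.mem_nhds τ.im_pos)).hasFDerivAt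
  set L := fderiv ℂ (fun x : ℂ × ℂ => f (ofComplex x.1, x.2)) ((τ : ℂ), z) with hL
  have key : ∀ {A B : ℂ → ℂ} {t A' B' : ℂ}, HasDerivAt A A' t → HasDerivAt B B' t → A t = τ →
      B t = z → HasDerivAt (fun s => f (ofComplex (A s), B s)) (L (A', B')) t := by
    intro A B t A' B' hA hB hτ hz
    rw [← hτ, ← hz] at h0
    exact h0.comp_hasDerivAt t (hA.prodMk hB)
  have h1 := key (hasDerivAt_id' (τ : ℂ)) (hasDerivAt_const _ z) rfl rfl
  have h2 := key (hasDerivAt_const z (τ : ℂ)) (hasDerivAt_id' z) rfl rfl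
  have hπ : (2 * π * I : ℂ) ≠ 0 := by simp [Real.pi_ne_zero]
  simp only [ofComplex_apply] at h2
  convert! key hA hB hτ hz using 1
  rw [Dτ, Dz, h1.deriv, h2.deriv]
  have : ((A', B') : ℂ × ℂ) = A' • (1, 0) + B' • (0, 1) := by simp
  rw [this, map_add, map_smul, map_smul, smul_eq_mul, smul_eq_mul]
  field_simp

lemma IsHolo.hasDerivAt_right {f : ℍ × ℂ → ℂ} (hf : IsHolo f) (τ : ℍ) (z : ℂ) :
    HasDerivAt (fun w => f (τ, w)) (2 * π * I * Dz f (τ, z)) z := by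
  have := hf.hasDerivAt_comp (hasDerivAt_const z (τ : ℂ)) (hasDerivAt_id' z) rfl rfl
  simpa using this

lemma IsHolo.hasDerivAt_left {f : ℍ × ℂ → ℂ} (hf : IsHolo f) (τ : ℍ) (z : ℂ) :
    HasDerivAt (fun t => f (ofComplex t, z)) (2 * π * I * Dτ f (τ, z)) τ := by
  have := hf.hasDerivAt_comp (hasDerivAt_id' (τ : ℂ)) (hasDerivAt_const _ z) rfl rfl
  simpa using this

lemma two_pi_I_ne_zero' : (2 * π * I : ℂ) ≠ 0 := by simp [Real.pi_ne_zero]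

lemma Dz_eq_of_hasDerivAt {F : ℍ × ℂ → ℂ} {τ : ℍ} {z d : ℂ}
    (h : HasDerivAt (fun w => F (τ, w)) (2 * π * I * d) z) : Dz F (τ, z) = d := by
  rw [Dz, h.deriv, inv_mul_cancel_left₀ two_pi_I_ne_zero']

lemma Dτ_eq_of_hasDerivAt {F : ℍ × ℂ → ℂ} {τ : ℍ} {z d : ℂ}
    (h : HasDerivAt (fun t => F (ofComplex t, z)) (2 * π * I * d) τ) : Dτ F (τ, z) = d := by
  rw [Dτ, h.deriv, inv_mul_cancel_left₀ two_pi_I_ne_zero']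

/-! ### Transformation laws of the derivatives of a Jacobi form -/

section

variable {k : ℤ} {p : ℕ} {f : ℍ × ℂ → ℂ}

/-- The factor of automorphy of index `p`. -/
def indexFactor (p : ℕ) (γ : SL(2, ℤ)) (τ : ℍ) (z : ℂ) : ℂ :=
  cexp (2 * π * I * (p * (γ 1 0 : ℂ) * z ^ 2 / denom γ τ))

lemma apply_smul {γ : SL(2, ℤ)} (hf : slashSL k p γ f = f) (τ : ℍ) (z : ℂ) :
    f (γ • τ, z / denom γ τ) = denom γ τ ^ k * indexFactor p γ τ z * f (τ, z) := by
  rw [← congrFun hf (τ, z)]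
  simp only [slashSL, indexFactor]
  have hd := denom_ne_zero' γ τ
  rw [zpow_neg, Complex.exp_neg]
  have := zpow_ne_zero k hd
  have h2 := Complex.exp_ne_zero (2 * π * I * (p * (γ 1 0 : ℂ) * z ^ 2 / denom γ τ))
  field_simp

/-- The error 2pX f, with X = cz/(cτ+d), is the logarithmic derivative of the index factor. -/
lemma Dz_smul (hh : IsHolo f) {γ : SL(2, ℤ)} (hf : slashSL k p γ f = f) (τ : ℍ) (z : ℂ) :
    Dz f (γ • τ, z / denom γ τ) = denom γ τ ^ (k + 1) * indexFactor p γ τ z *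
      (Dz f (τ, z) + 2 * p * (γ 1 0 * z / denom γ τ) * f (τ, z)) := by
  have hd := denom_ne_zero' γ τ
  have h1 := hh.hasDerivAt_comp (hasDerivAt_const z ((γ • τ : ℍ) : ℂ))
    ((hasDerivAt_id' z).div_const (denom γ τ)) rfl rfl
  simp only [ofComplex_apply] at h1
  simp only [apply_smul hf] at h1
  have h2 : HasDerivAt (fun w => denom γ τ ^ k * indexFactor p γ τ w * f (τ, w)) _ z :=
    ((((((hasDerivAt_id' z).pow 2).const_mul (p * (γ 1 0 : ℂ))).div_const
      (denom γ τ)).const_mul (2 * π * I)).cexp.const_mul (denom γ τ ^ k)).mul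
      (hh.hasDerivAt_right τ z)
  have h3 := h1.unique h2
  change _ = denom γ τ ^ k * (indexFactor p γ τ z * _) * _ +
    denom γ τ ^ k * indexFactor p γ τ z * _ at h3
  rw [← mul_right_inj' (mul_ne_zero two_pi_I_ne_zero' (inv_ne_zero hd)), zpow_add_one₀ hd]
  simp only [zero_mul, zero_add, one_div] at h3
  rw [mul_assoc, h3]
  push_cast
  field_simp
  ring

/-- Here z/(cτ+d) also moves with τ, which produces the X D_z f term; the weight factor gives the
c/(cτ+d) term and the index factor the X² term. -/
lemma Dτ_smul (hh : IsHolo f) {γ : SL(2, ℤ)} (hf : slashSL k p γ f = f) (τ : ℍ) (z : ℂ) :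
    Dτ f (γ • τ, z / denom γ τ) = denom γ τ ^ (k + 2) * indexFactor p γ τ z *
      (Dτ f (τ, z) + (γ 1 0 * z / denom γ τ) * Dz f (τ, z) +
        (k * (2 * π * I)⁻¹ * (γ 1 0 / denom γ τ) + p * (γ 1 0 * z / denom γ τ) ^ 2) *
          f (τ, z)) := by
  have hd := denom_ne_zero' γ τ
  have hdet : (γ 0 0 : ℂ) * γ 1 1 - γ 0 1 * γ 1 0 = 1 := by
    have := γ.det_coe
    rw [Matrix.det_fin_two] at this
    exact_mod_cast this
  have hj : HasDerivAt (fun t : ℂ => (γ 1 0 : ℂ) * t + γ 1 1) (γ 1 0) τ := by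
    simpa using ((hasDerivAt_id' (τ : ℂ)).const_mul (γ 1 0 : ℂ)).add_const (γ 1 1 : ℂ)
  have hn : HasDerivAt (fun t : ℂ => (γ 0 0 : ℂ) * t + γ 0 1) (γ 0 0) τ := by
    simpa using ((hasDerivAt_id' (τ : ℂ)).const_mul (γ 0 0 : ℂ)).add_const (γ 0 1 : ℂ)
  have hd' : (γ 1 0 : ℂ) * τ + γ 1 1 ≠ 0 := by rwa [← denom_eq]
  have h1 := hh.hasDerivAt_comp (τ := γ • τ) (z := z / denom γ τ) (hn.div hj hd')
    ((hasDerivAt_const (τ : ℂ) z).div hj hd') (by rw [coe_smul_eq, denom_eq]; rfl)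
    (by rw [denom_eq]; rfl)
  have h2 : HasDerivAt (fun t : ℂ => ((γ 1 0 : ℂ) * t + γ 1 1) ^ k *
      cexp (2 * π * I * (p * (γ 1 0 : ℂ) * z ^ 2 / ((γ 1 0 : ℂ) * t + γ 1 1))) *
      f (ofComplex t, z)) _ τ :=
    (((hasDerivAt_zpow k _ (Or.inl hd')).comp (τ : ℂ) hj).mul
      ((((hasDerivAt_const (τ : ℂ) (p * (γ 1 0 : ℂ) * z ^ 2)).div hj hd').const_mul
        (2 * π * I)).cexp)).mul (hh.hasDerivAt_left τ z)
  have h3 := (h2.congr_of_eventuallyEq (f₁ := fun s => f (ofComplex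
    (((γ 0 0 : ℂ) * s + γ 0 1) / ((γ 1 0 : ℂ) * s + γ 1 1)), z / ((γ 1 0 : ℂ) * s + γ 1 1))) (by
      filter_upwards [isOpen_upperHalfPlaneSet.mem_nhds τ.im_pos] with s hs
      have h4 := apply_smul hf (ofComplex s) z
      have h5 : ((γ • ofComplex s : ℍ) : ℂ) = _ := coe_smul_eq γ (ofComplex s)
      rw [← ofComplex_apply (γ • ofComplex s)] at h4
      rw [h5] at h4
      simp only [indexFactor, ofComplex_apply_of_im_pos hs] at h4 ⊢
      exact h4))
  have h4 := h1.unique h3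
  change _ = _ + (((γ 1 0 : ℂ) * τ + γ 1 1) ^ k * _) * _ at h4
  simp only [← denom_eq, Function.comp, ofComplex_apply] at h4
  change _ = (_ * indexFactor p γ τ z + _ * (indexFactor p γ τ z * _)) * _ +
    _ * indexFactor p γ τ z * _ at h4
  rw [Dz_smul hh hf, zpow_add_one₀ hd, zpow_sub_one₀ hd] at h4
  rw [zpow_add₀ hd, zpow_ofNat]
  rw [← mul_right_inj' (mul_ne_zero two_pi_I_ne_zero' (inv_ne_zero (pow_ne_zero 2 hd)))]
  have h5 : ((γ 0 0 : ℂ) * denom γ τ - (γ 0 0 * τ + γ 0 1) * γ 1 0) = 1 := by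
    rw [denom_eq]
    linear_combination hdet
  rw [h5] at h4
  generalize Dτ f (γ • τ, z / denom γ τ) = X at *
  generalize denom γ τ = j at *
  have := two_pi_I_ne_zero'
  linear_combination (norm := skip) h4
  field_simp
  ring

lemma apply_add {a b : ℤ} (hf : slashZ p a b f = f) (τ : ℍ) (z : ℂ) :
    f (τ, z) = cexp (2 * π * I * (p * ((a : ℂ) ^ 2 * τ + 2 * a * z))) *
      f (τ, z + a * τ + b) := (congrFun hf (τ, z)).symm

lemma Dz_add (hh : IsHolo f) {a b : ℤ} (hf : slashZ p a b f = f) (τ : ℍ) (z : ℂ) :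
    Dz f (τ, z) = cexp (2 * π * I * (p * ((a : ℂ) ^ 2 * τ + 2 * a * z))) *
      (Dz f (τ, z + a * τ + b) + 2 * p * a * f (τ, z + a * τ + b)) := by
  refine Dz_eq_of_hasDerivAt ?_
  have h1 := hh.hasDerivAt_comp (hasDerivAt_const z (τ : ℂ))
    (((hasDerivAt_id' z).add_const (a * τ : ℂ)).add_const (b : ℂ)) rfl rfl
  simp only [ofComplex_apply] at h1
  have h2 := ((((((hasDerivAt_id' z).const_mul (2 * a : ℂ)).const_add
    ((a : ℂ) ^ 2 * τ)).const_mul (p : ℂ)).const_mul (2 * π * I)).cexp).mul h1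
  refine (h2.congr_of_eventuallyEq (.of_forall fun w => apply_add hf τ w)).congr_deriv ?_
  ring

lemma Dτ_add (hh : IsHolo f) {a b : ℤ} (hf : slashZ p a b f = f) (τ : ℍ) (z : ℂ) :
    Dτ f (τ, z) = cexp (2 * π * I * (p * ((a : ℂ) ^ 2 * τ + 2 * a * z))) *
      (Dτ f (τ, z + a * τ + b) + a * Dz f (τ, z + a * τ + b) +
        p * a ^ 2 * f (τ, z + a * τ + b)) := by
  refine Dτ_eq_of_hasDerivAt ?_
  have h1 := hh.hasDerivAt_comp (hasDerivAt_id' (τ : ℂ))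
    ((((hasDerivAt_id' (τ : ℂ)).const_mul (a : ℂ)).const_add z).add_const (b : ℂ)) rfl rfl
  have h2 := ((((((hasDerivAt_id' (τ : ℂ)).const_mul ((a : ℂ) ^ 2)).add_const
    (2 * a * z)).const_mul (p : ℂ)).const_mul (2 * π * I)).cexp).mul h1
  refine (h2.congr_of_eventuallyEq ?_).congr_deriv ?_
  · filter_upwards [isOpen_upperHalfPlaneSet.mem_nhds τ.im_pos] with s hs
    have := apply_add hf (ofComplex s) z
    change f (ofComplex s, z) = cexp (2 * π * I * (p * ((a : ℂ) ^ 2 * s + 2 * a * z))) *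
      f (ofComplex s, z + a * s + b)
    rw [ofComplex_apply_of_im_pos hs] at this ⊢
    exact this
  · simp only [ofComplex_apply]
    ring

/-! ### Transformation laws of `J₂` and of the formula for `Ob` -/

lemma hasDerivAt_J₁ {τ : ℍ} {z : ℂ} (hz : z ∉ latt τ) :
    HasDerivAt (fun w => J₁ (τ, w)) (2 * π * I * Dz J₁ (τ, z)) z := by
  have := (differentiableAt_J₁ hz).hasDerivAt
  rwa [Dz, mul_inv_cancel_left₀ two_pi_I_ne_zero']

lemma J₂_smul (γ : SL(2, ℤ)) {τ : ℍ} {z : ℂ} (hz : z ∉ latt τ) :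
    J₂ (γ • τ, z / denom γ τ) = denom γ τ ^ 2 *
      (J₂ (τ, z) + 2 * (γ 1 0 * z / denom γ τ) * J₁ (τ, z) + (γ 1 0 * z / denom γ τ) ^ 2) := by
  have hd := denom_ne_zero' γ τ
  have hz' : z / denom γ τ ∉ latt (γ • τ) := by
    rwa [mem_latt_smul, div_mul_cancel₀ _ hd]
  have h1 := (hasDerivAt_J₁ hz').comp z ((hasDerivAt_id' z).div_const (denom γ τ))
  have h2 := ((hasDerivAt_J₁ hz).const_mul (denom γ τ)).add
    ((hasDerivAt_id' z).const_mul (γ 1 0 : ℂ))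
  have h3 := h1.unique (h2.congr_of_eventuallyEq (.of_forall fun w => J₁_smul γ τ w))
  have h4 : Dz J₁ (γ • τ, z / denom γ τ) =
      denom γ τ ^ 2 * Dz J₁ (τ, z) + (2 * π * I)⁻¹ * γ 1 0 * denom γ τ := by
    have := two_pi_I_ne_zero'
    rw [← mul_right_inj' (mul_ne_zero this (inv_ne_zero hd))]
    linear_combination (norm := skip) h3
    field_simp
    ring
  simp only [J₂, h4, J₁_smul, E2_smul]
  field_simp
  ring

lemma J₂_add {τ : ℍ} {z : ℂ} (hz : z ∉ latt τ) (a b : ℤ) :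
    J₂ (τ, z + a * τ + b) = J₂ (τ, z) - 2 * a * J₁ (τ, z) + a ^ 2 := by
  have h4 : Dz J₁ (τ, z + a * τ + b) = Dz J₁ (τ, z) := by
    have hz' : z + a * τ + b ∉ latt τ := fun h => hz <| by
      have h1 : (b + a * τ : ℂ) ∈ latt τ := mem_latt.mpr ⟨b, a, rfl⟩
      have h2 := sub_mem h h1
      rwa [show z + a * τ + b - (b + a * τ) = z by ring] at h2
    refine (Dz_eq_of_hasDerivAt ?_).symm
    have h1 := (hasDerivAt_J₁ hz').comp z
      (((hasDerivAt_id' z).add_const (a * τ : ℂ)).add_const (b : ℂ))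
    rw [mul_one] at h1
    refine (h1.add_const (a : ℂ)).congr_of_eventuallyEq ?_
    filter_upwards [(isClosed_latt τ).isOpen_compl.mem_nhds hz] with w hw
    simp [Function.comp, J₁_add hw]
  simp only [J₂, h4, J₁_add hz]
  ring

/-- With X = cz/(cτ+d): the X D_z f terms cancel, so do the X J₁ f terms, the X² f terms add up to p
− 2p + p = 0, and the E₂ anomaly cancels the weight term. -/
lemma obFormula_smul (hh : IsHolo f) {γ : SL(2, ℤ)} (hf : slashSL k p γ f = f) {τ : ℍ} {z : ℂ}
    (hz : z ∉ latt τ) :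
    slashSL (k + 2) p γ (obFormula k p f) (τ, z) = obFormula k p f (τ, z) := by
  have hd := denom_ne_zero' γ τ
  have hk := zpow_ne_zero k hd
  have hE : indexFactor p γ τ z ≠ 0 := Complex.exp_ne_zero _
  simp only [slashSL, obFormula, Complex.exp_neg]
  change _ * (indexFactor p γ τ z)⁻¹ * _ = _
  rw [Dτ_smul hh hf, Dz_smul hh hf, apply_smul hf, J₁_smul, J₂_smul γ hz, E2_smul, zpow_neg,
    zpow_add₀ hd, zpow_add₀ hd, zpow_one, zpow_ofNat]
  have := two_pi_I_ne_zero'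
  field_simp
  ring

/-- The same cancellation, with the integer a in place of X. -/
lemma obFormula_add (hh : IsHolo f) {a b : ℤ} (hf : slashZ p a b f = f) {τ : ℍ} {z : ℂ}
    (hz : z ∉ latt τ) :
    slashZ p a b (obFormula k p f) (τ, z) = obFormula k p f (τ, z) := by
  simp only [slashZ, obFormula]
  rw [Dτ_add hh hf τ z, Dz_add hh hf τ z, J₁_add hz, J₂_add hz, apply_add hf τ z]
  ring

end

end

end WeakJacobi

namespace WeakJacobi

noncomputable section

/-! ### The operator `Ob` on the space of weak Jacobi forms -/

section

variable {k : ℤ} {p : ℕ} {f : ℍ × ℂ → ℂ}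

lemma exists_expandsOn (hf : f ∈ weakJacobiForms k p) : Expandable Set.univ f := by
  obtain ⟨-, -, -, c, -, hc⟩ := hf
  exact ⟨c, fun x _ => hc x⟩

lemma differentiable_of_expandable (hf : Expandable Set.univ f) (τ : ℍ) :
    Differentiable ℂ fun z => f (τ, z) := by
  obtain ⟨c, hc⟩ := hf
  exact hc.isHolo.differentiable_right τ

/-- The matrix −1 fixes τ and sends z to −z with sign (−1)^k. -/
lemma apply_neg (hk : Even k) (hf : f ∈ weakJacobiForms k p) (τ : ℍ) (z : ℂ) :
    f (τ, -z) = f (τ, z) := by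
  have h := apply_smul (hf.2.1 (-1)) τ z
  have hd : denom (-1 : SL(2, ℤ)) τ = -1 := by
    rw [denom_eq]
    simp
  have h2 : (-1 : SL(2, ℤ)) • τ = τ := by simp
  rw [hd, h2] at h
  simpa [indexFactor, hk.neg_one_zpow, div_neg] using h

lemma Dz_zero (hk : Even k) (hf : f ∈ weakJacobiForms k p) (τ : ℍ) : Dz f (τ, 0) = 0 := by
  have h1 : HasDerivAt (fun w => f (τ, -w)) _ 0 :=
    (show HasDerivAt (fun w => f (τ, w)) _ (-0) from hf.1.hasDerivAt_right τ _).comp (0 : ℂ)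
      (hasDerivAt_neg (0 : ℂ))
  simp only [apply_neg hk hf, neg_zero] at h1
  have h2 := h1.unique (hf.1.hasDerivAt_right τ 0)
  have := two_pi_I_ne_zero'
  have h3 : (2 * π * I) * Dz f (τ, 0) = 0 := by linear_combination (-1 / 2 : ℂ) * h2
  exact (mul_eq_zero.mp h3).resolve_left this

lemma differentiableAt_obFormula (hf : f ∈ weakJacobiForms k p) {τ : ℍ} {z : ℂ}
    (hz : z ∉ latt τ) : DifferentiableAt ℂ (fun w => obFormula k p f (τ, w)) z := by
  have hexp := exists_expandsOn hf
  have h1 := differentiable_of_expandable hexp τ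
  have h2 := differentiable_of_expandable (hexp.dτ isOpen_univ) τ
  have h3 := differentiable_of_expandable (hexp.dz isOpen_univ) τ
  have h4 := differentiableAt_J₁ hz
  have h5 : DifferentiableAt ℂ (fun w => Dz J₁ (τ, w)) z := by
    have : DifferentiableOn ℂ (fun w => J₁ (τ, w)) (latt τ : Set ℂ)ᶜ := fun w hw =>
      (differentiableAt_J₁ hw).differentiableWithinAt
    exact ((this.deriv (isClosed_latt τ).isOpen_compl).differentiableAt
      ((isClosed_latt τ).isOpen_compl.mem_nhds hz)).const_mul _
  have h6 : DifferentiableAt ℂ (fun w => J₂ (τ, w)) z := by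
    simp only [J₂]
    exact (h5.fun_sub (differentiableAt_const _)).fun_add (h4.fun_pow 2)
  simp only [obFormula]
  refine DifferentiableAt.fun_add (DifferentiableAt.fun_sub (DifferentiableAt.fun_sub (h2 z) ?_) ?_) ?_
  · exact (h1 z).const_mul _
  · exact h4.fun_mul (h3 z)
  · exact (h6.const_mul _).fun_mul (h1 z)

/-- Near `z = 0` the formula for `Ob` has at most a removable singularity. -/
lemma tendsto_mul_obFormula (hk : Even k) (hf : f ∈ weakJacobiForms k p) (τ : ℍ) :
    Tendsto (fun z => z * obFormula k p f (τ, z)) (𝓝[≠] 0) (𝓝 0) := by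
  have hexp := exists_expandsOn hf
  have h1 := (differentiable_of_expandable hexp τ).continuous
  have h2 := (differentiable_of_expandable (hexp.dτ isOpen_univ) τ).continuous
  have h3 := (differentiable_of_expandable (hexp.dz isOpen_univ) τ).continuous
  have hmem : ((latt τ : Set ℂ) \ {0})ᶜ ∈ 𝓝 (0 : ℂ) :=
    (isOpen_compl_latt_sdiff τ).mem_nhds (by simp)
  have hreg := (differentiableOn_J₁Reg τ).analyticAt hmem
  have h4 := hreg.continuousAt
  have h5 := hreg.deriv.continuousAt
  have h6 : Tendsto (fun z => J₁Reg τ z / z) (𝓝[≠] 0) (𝓝 (deriv (J₁Reg τ) 0)) := by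
    have := hreg.differentiableAt.hasDerivAt.tendsto_slope
    refine this.congr fun z => ?_
    simp [slope_def_field]
  set a : ℂ := (2 * π * I)⁻¹ with ha
  -- The pole −a²/z² of D_z J₁ cancels that of J₁². The cross term 2a·J₁Reg(z)/z stays bounded
  -- because J₁Reg vanishes at 0.
  have key : ∀ᶠ z in 𝓝[≠] (0 : ℂ), z * Dτ f (τ, z) -
      (k : ℂ) / 12 * EisensteinSeries.E2 τ * (z * f (τ, z)) -
      (a + z * J₁Reg τ z) * Dz f (τ, z) +
      (p : ℂ) * (z * (a * deriv (J₁Reg τ) z + 2 * a * (J₁Reg τ z / z) + J₁Reg τ z ^ 2 -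
        1 / 12 * EisensteinSeries.E2 τ)) * f (τ, z) = z * obFormula k p f (τ, z) := by
    filter_upwards [self_mem_nhdsWithin,
      nhdsWithin_le_nhds ((isOpen_compl_latt_sdiff τ).mem_nhds (show (0 : ℂ) ∈ _ by simp))]
      with z hz0 hz
    have hz0' : z ≠ 0 := hz0
    have hd : HasDerivAt (fun w => J₁ (τ, w)) (a * (-1 / z ^ 2) + deriv (J₁Reg τ) z) z := by
      simp only [J₁_eq_add]
      have := ((differentiableOn_J₁Reg τ).differentiableAt
        ((isOpen_compl_latt_sdiff τ).mem_nhds hz)).hasDerivAt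
      simp only [one_div]
      refine (((hasDerivAt_inv hz0').const_mul a).fun_add this).congr_deriv ?_
      rw [neg_div, one_div]
    have hJ : Dz J₁ (τ, z) = a * (a * (-1 / z ^ 2) + deriv (J₁Reg τ) z) := by
      rw [Dz, hd.deriv]
    simp only [obFormula, J₂, hJ, J₁_eq_add]
    rw [← ha]
    field_simp
    ring
  refine Tendsto.congr' key ?_
  have t0 : Tendsto (fun z : ℂ => z) (𝓝[≠] 0) (𝓝 0) := tendsto_id.mono_left nhdsWithin_le_nhds
  have t1 := (h1.tendsto 0).mono_left (nhdsWithin_le_nhds (s := {0}ᶜ))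
  have t2 := (h2.tendsto 0).mono_left (nhdsWithin_le_nhds (s := {0}ᶜ))
  have t3 := (h3.tendsto 0).mono_left (nhdsWithin_le_nhds (s := {0}ᶜ))
  have t4 := h4.tendsto.mono_left (nhdsWithin_le_nhds (s := {0}ᶜ))
  have t5 := h5.tendsto.mono_left (nhdsWithin_le_nhds (s := {0}ᶜ))
  have t := (((t0.mul t2).sub ((t0.mul t1).const_mul
    ((k : ℂ) / 12 * EisensteinSeries.E2 τ))).sub (((t0.mul t4).const_add a).mul t3)).add
    (((t0.mul ((((t5.const_mul a).add (h6.const_mul (2 * a))).add (t4.pow 2)).sub_const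
      (1 / 12 * EisensteinSeries.E2 τ))).const_mul (p : ℂ)).mul t1)
  -- The only surviving contribution to the limit is −a·D_z f(τ, 0), which is zero by evenness.
  simpa [Dz_zero hk hf] using t

/-- The limit that defines `Ob` at lattice points exists at the origin. -/
lemma tendsto_obFormula_zero (hk : Even k) (hf : f ∈ weakJacobiForms k p) (τ : ℍ) :
    Tendsto (fun z => obFormula k p f (τ, z)) (𝓝[≠] 0) (𝓝 (Ob k p f (τ, 0))) := by
  have h0 : Ob k p f (τ, 0) = limUnder (𝓝[≠] 0) fun w : ℂ => obFormula k p f (τ, w) :=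
    if_pos (zero_mem (latt τ))
  rw [h0]
  refine Complex.tendsto_limUnder_of_differentiable_on_punctured_nhds_of_isLittleO ?_ ?_
  · filter_upwards [eventually_notMem_latt τ 0] with w hw
    exact differentiableAt_obFormula hf hw
  · rw [Asymptotics.isLittleO_iff_tendsto']
    · have h1 := (tendsto_mul_obFormula hk hf τ).sub
        ((tendsto_id.mono_left nhdsWithin_le_nhds :
          Tendsto id (𝓝[≠] (0 : ℂ)) (𝓝 0)).mul_const (obFormula k p f (τ, 0)))
      rw [zero_mul, sub_zero] at h1
      refine h1.congr fun z => ?_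
      simp [div_inv_eq_mul]
      ring
    · filter_upwards [self_mem_nhdsWithin] with z hz h
      simp at h hz
      exact absurd h hz

lemma Ob_of_notMem {τ : ℍ} {z : ℂ} (hz : z ∉ latt τ) :
    Ob k p f (τ, z) = obFormula k p f (τ, z) := if_neg hz

/-- `Ob` is everywhere the limit of the formula that defines it outside the lattice. -/
lemma tendsto_obFormula (hk : Even k) (hf : f ∈ weakJacobiForms k p) (τ : ℍ) (z : ℂ) :
    Tendsto (fun w => obFormula k p f (τ, w)) (𝓝[≠] z) (𝓝 (Ob k p f (τ, z))) := by
  by_cases hz : z ∈ latt τ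
  · have h0 : Ob k p f (τ, z) = limUnder (𝓝[≠] z) fun w : ℂ => obFormula k p f (τ, w) :=
      if_pos hz
    rw [h0]
    refine tendsto_nhds_limUnder ?_
    obtain ⟨b, a, hab⟩ := mem_latt.mp hz
    have hmap : Tendsto (fun w => w - z) (𝓝[≠] z) (𝓝[≠] 0) := by
      refine tendsto_nhdsWithin_of_tendsto_nhds_of_eventually_within _ ?_ ?_
      · have : Tendsto (fun w => w - z) (𝓝 z) (𝓝 (z - z)) :=
          (continuous_id.sub continuous_const).tendsto z
        rw [sub_self] at this
        exact this.mono_left nhdsWithin_le_nhds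
      · filter_upwards [self_mem_nhdsWithin] with w hw
        exact sub_ne_zero.mpr hw
    have hexp : Tendsto (fun w => cexp (-(2 * π * I * (p * ((a : ℂ) ^ 2 * τ + 2 * a * (w - z))))))
        (𝓝[≠] z) (𝓝 (cexp (-(2 * π * I * (p * ((a : ℂ) ^ 2 * τ + 2 * a * (z - z))))))) := by
      refine Tendsto.mono_left (Continuous.tendsto ?_ z) nhdsWithin_le_nhds
      fun_prop
    -- Elliptic invariance off the lattice transports the limit at the origin to z = b + aτ.
    refine ⟨_, (hexp.mul ((tendsto_obFormula_zero hk hf τ).comp hmap)).congr' ?_⟩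
    filter_upwards [eventually_notMem_latt τ z] with w hw
    have hw' : w - z ∉ latt τ := fun h => hw (by simpa using add_mem h hz)
    have h1 := obFormula_add (k := k) hf.1 (hf.2.2.1 a b) hw'
    rw [slashZ] at h1
    simp only [Function.comp]
    rw [← h1, ← mul_assoc, ← Complex.exp_add, neg_add_cancel, Complex.exp_zero, one_mul]
    congr 2
    rw [← hab]
    ring
  · rw [Ob_of_notMem hz]
    exact (differentiableAt_obFormula hf hz).continuousAt.tendsto.mono_left nhdsWithin_le_nhds

/-- Identities between values of `Ob` may be checked outside the lattice. -/
lemma tendsto_Ob (hk : Even k) (hf : f ∈ weakJacobiForms k p) (τ : ℍ) (z : ℂ) :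
    Tendsto (fun w => Ob k p f (τ, w)) (𝓝[≠] z) (𝓝 (Ob k p f (τ, z))) := by
  refine (tendsto_obFormula hk hf τ z).congr' ?_
  filter_upwards [eventually_notMem_latt τ z] with w hw
  exact (Ob_of_notMem hw).symm

lemma differentiable_Ob (hk : Even k) (hf : f ∈ weakJacobiForms k p) (τ : ℍ) :
    Differentiable ℂ fun z => Ob k p f (τ, z) := fun z => by
  have hd : ∀ w ∉ latt τ, DifferentiableAt ℂ (fun z => Ob k p f (τ, z)) w := fun w hw => by
    refine (differentiableAt_obFormula hf hw).congr_of_eventuallyEq ?_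
    filter_upwards [(isClosed_latt τ).isOpen_compl.mem_nhds hw] with v hv
    exact Ob_of_notMem hv
  refine (Complex.analyticAt_of_differentiable_on_punctured_nhds_of_continuousAt ?_
    ?_).differentiableAt
  · filter_upwards [eventually_notMem_latt τ z] with w hw
    exact hd w hw
  · exact continuousAt_iff_punctured_nhds.mpr (tendsto_Ob hk hf τ z)

/-- Entire functions in `z` that agree outside the lattice are equal. -/
lemma eq_of_eq_on_compl_latt {F G : ℍ × ℂ → ℂ} (hF : ∀ τ, Continuous fun z => F (τ, z))
    (hG : ∀ τ, Continuous fun z => G (τ, z)) (h : ∀ τ, ∀ z ∉ latt τ, F (τ, z) = G (τ, z)) :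
    F = G := by
  ext ⟨τ, z⟩
  refine tendsto_nhds_unique_of_eventuallyEq
    (((hF τ).tendsto z).mono_left (nhdsWithin_le_nhds (s := {z}ᶜ)))
    (((hG τ).tendsto z).mono_left nhdsWithin_le_nhds) ?_
  filter_upwards [eventually_notMem_latt τ z] with w hw
  exact h τ w hw

/-- The strip contains no lattice points, so there the formula itself applies, and all its
ingredients are expandable. -/
lemma expandable_Ob (hf : f ∈ weakJacobiForms k p) : Expandable strip (Ob k p f) := by
  have hexp := exists_expandsOn hf
  have h1 := hexp.mono (Set.subset_univ strip)
  have h2 := (hexp.dτ isOpen_univ).mono (Set.subset_univ strip)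
  have h3 := (hexp.dz isOpen_univ).mono (Set.subset_univ strip)
  have h4 := Expandable.J₁
  have h5 := h4.dz isOpen_strip
  have h6 : Expandable strip fun x => EisensteinSeries.E2 x.1 := Expandable.E2
  have hJ₂ : Expandable strip J₂ := ((h5.sub (h6.const_smul (1 / 12))).add (h4.mul h4)).congr
    fun x _ => by simp [J₂, sq]
  refine (((h2.sub ((h6.mul h1).const_smul ((k : ℂ) / 12))).sub (h4.mul h3)).add
    ((hJ₂.mul h1).const_smul (p : ℂ))).congr fun x hx => ?_
  rw [show x = (x.1, x.2) from rfl, Ob_of_notMem]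
  · simp [obFormula, mul_assoc]
  · exact notMem_latt_of_mem_strip hx

/-- `Ob` maps weak Jacobi forms of even weight `k` to weak Jacobi forms of weight `k + 2`. -/
theorem Ob_mem (hk : Even k) (hf : f ∈ weakJacobiForms k p) :
    Ob k p f ∈ weakJacobiForms (k + 2) p := by
  have hd := differentiable_Ob hk hf
  have hell : ∀ a b, slashZ p a b (Ob k p f) = Ob k p f := fun a b => by
    refine eq_of_eq_on_compl_latt (fun τ => ?_) (fun τ => (hd τ).continuous) fun τ z hz => ?_
    · have h1 := (hd τ).continuous
      have h2 : Continuous fun z => Ob k p f (τ, z + a * τ + b) :=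
        h1.comp (by fun_prop : Continuous fun z : ℂ => z + a * τ + b)
      simp only [slashZ]
      fun_prop
    · have hz' : z + a * τ + b ∉ latt τ := fun h => hz <| by
        have h1 : (b + a * τ : ℂ) ∈ latt τ := mem_latt.mpr ⟨b, a, rfl⟩
        have h2 := sub_mem h h1
        rwa [show z + a * τ + b - (b + a * τ) = z by ring] at h2
      rw [Ob_of_notMem hz, ← obFormula_add hf.1 (hf.2.2.1 a b) hz]
      simp only [slashZ, Ob_of_notMem hz']
  -- So far Ob(f) is only known to be entire in z for each τ; joint holomorphy comes from the
  -- expansion.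
  obtain ⟨h1, h2⟩ := isHolo_and_hasWeakFourierExpansion hd hell (expandable_Ob hf)
  refine ⟨h1, fun γ => ?_, hell, h2⟩
  refine eq_of_eq_on_compl_latt (fun τ => ?_) (fun τ => (hd τ).continuous) fun τ z hz => ?_
  · have h1 := (hd (γ • τ)).continuous
    have h2 : Continuous fun z => Ob k p f (γ • τ, z / denom γ τ) :=
      h1.comp (by fun_prop : Continuous fun z : ℂ => z / denom γ τ)
    simp only [slashSL]
    fun_prop
  · have hz' : z / denom γ τ ∉ latt (γ • τ) := by
      rwa [mem_latt_smul, div_mul_cancel₀ _ (denom_ne_zero' γ τ)]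
    rw [Ob_of_notMem hz, ← obFormula_smul hf.1 (hf.2.1 γ) hz]
    simp only [slashSL, Ob_of_notMem hz']

end

end

end WeakJacobi

namespace WeakJacobi

noncomputable section

/-! ### Linearity and the Leibniz rule -/

lemma Ob_add {k : ℤ} {p : ℕ} {f g : ℍ × ℂ → ℂ} (hk : Even k) (hf : f ∈ weakJacobiForms k p)
    (hg : g ∈ weakJacobiForms k p) : Ob k p (f + g) = Ob k p f + Ob k p g := by
  refine eq_of_eq_on_compl_latt
    (fun τ => (differentiable_Ob hk (Submodule.add_mem _ hf hg) τ).continuous)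
    (fun τ => (differentiable_Ob hk hf τ).continuous.add (differentiable_Ob hk hg τ).continuous)
    fun τ z hz => ?_
  have h1 : Dz (f + g) (τ, z) = Dz f (τ, z) + Dz g (τ, z) := Dz_eq_of_hasDerivAt <|
    ((hf.1.hasDerivAt_right τ z).add (hg.1.hasDerivAt_right τ z)).congr_deriv (by ring)
  have h2 : Dτ (f + g) (τ, z) = Dτ f (τ, z) + Dτ g (τ, z) := Dτ_eq_of_hasDerivAt <|
    ((hf.1.hasDerivAt_left τ z).add (hg.1.hasDerivAt_left τ z)).congr_deriv (by ring)
  simp only [Pi.add_apply, Ob_of_notMem hz, obFormula, h1, h2]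
  ring

lemma Ob_smul {k : ℤ} {p : ℕ} {f : ℍ × ℂ → ℂ} (hk : Even k) (s : ℂ)
    (hf : f ∈ weakJacobiForms k p) : Ob k p (s • f) = s • Ob k p f := by
  refine eq_of_eq_on_compl_latt
    (fun τ => (differentiable_Ob hk (Submodule.smul_mem _ s hf) τ).continuous)
    (fun τ => (differentiable_Ob hk hf τ).continuous.const_smul s) fun τ z hz => ?_
  have h1 : Dz (s • f) (τ, z) = s * Dz f (τ, z) := Dz_eq_of_hasDerivAt <|
    ((hf.1.hasDerivAt_right τ z).const_mul s).congr_deriv (by ring)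
  have h2 : Dτ (s • f) (τ, z) = s * Dτ f (τ, z) := Dτ_eq_of_hasDerivAt <|
    ((hf.1.hasDerivAt_left τ z).const_mul s).congr_deriv (by ring)
  simp only [Pi.smul_apply, smul_eq_mul, Ob_of_notMem hz, obFormula, h1, h2]
  ring

/-- D_τ and D_z obey the Leibniz rule, while the E₂ and J₂ terms are multiplications by functions
additive in weight and index. -/
lemma Ob_mul {k l : ℤ} {p q : ℕ} {f g : ℍ × ℂ → ℂ} (hk : Even k) (hl : Even l)
    (hf : f ∈ weakJacobiForms k p) (hg : g ∈ weakJacobiForms l q) :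
    Ob (k + l) (p + q) (f * g) = Ob k p f * g + f * Ob l q g := by
  refine eq_of_eq_on_compl_latt
    (fun τ => (differentiable_Ob (hk.add hl) (mul_mem_weakJacobiForms hf hg) τ).continuous)
    (fun τ => (((differentiable_Ob hk hf τ).mul (hg.1.differentiable_right τ)).add
      ((hf.1.differentiable_right τ).mul (differentiable_Ob hl hg τ))).continuous)
    fun τ z hz => ?_
  have h1 : Dz (f * g) (τ, z) = Dz f (τ, z) * g (τ, z) + f (τ, z) * Dz g (τ, z) :=
    Dz_eq_of_hasDerivAt <|
      ((hf.1.hasDerivAt_right τ z).mul (hg.1.hasDerivAt_right τ z)).congr_deriv (by ring)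
  have h2 : Dτ (f * g) (τ, z) = Dτ f (τ, z) * g (τ, z) + f (τ, z) * Dτ g (τ, z) :=
    Dτ_eq_of_hasDerivAt <|
      ((hf.1.hasDerivAt_left τ z).mul (hg.1.hasDerivAt_left τ z)).congr_deriv (by
        simp only [ofComplex_apply]
        ring)
  simp only [Pi.add_apply, Pi.mul_apply, Ob_of_notMem hz, obFormula, h1, h2]
  push_cast
  ring

/-- `Ob` as a linear map on the space of weak Jacobi forms of even weight `k` and index `p`. -/
def obLinearMap {k : ℤ} (p : ℕ) (hk : Even k) :
    weakJacobiForms k p →ₗ[ℂ] weakJacobiForms (k + 2) p where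
  toFun f := ⟨Ob k p f, Ob_mem hk f.2⟩
  map_add' f g := Subtype.ext (Ob_add hk f.2 g.2)
  map_smul' s f := Subtype.ext (Ob_smul hk s f.2)

/-! ### The derivation of the bigraded algebra -/

lemma mem_of_weight_eq {k l : ℤ} {p : ℕ} {f : ℍ × ℂ → ℂ} (h : k = l)
    (hf : f ∈ weakJacobiForms k p) : f ∈ weakJacobiForms l p :=
  h ▸ hf

lemma Ob_mem_evComponent (i : ℤ × ℕ) (f : evComponent i) :
    Ob (2 * i.1) i.2 f ∈ evComponent (i.1 + 1, i.2) :=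
  mem_of_weight_eq (mul_add_one 2 i.1).symm (Ob_mem (even_two_mul i.1) f.2)

/-- `Ob` on a homogeneous component. -/
def obComponent (i : ℤ × ℕ) : evComponent i →ₗ[ℂ] evComponent (i.1 + 1, i.2) where
  toFun f := ⟨Ob (2 * i.1) i.2 f, Ob_mem_evComponent i f⟩
  map_add' f g := Subtype.ext (Ob_add (even_two_mul _) f.2 g.2)
  map_smul' s f := Subtype.ext (Ob_smul (even_two_mul _) s f.2)

/-- The linear extension of `Ob` to the bigraded algebra. -/
def obTotal : EvWeakJacobi →ₗ[ℂ] EvWeakJacobi :=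
  DirectSum.toModule ℂ _ _ fun i =>
    DirectSum.lof ℂ (ℤ × ℕ) (fun i => evComponent i) (i.1 + 1, i.2) ∘ₗ obComponent i

lemma obTotal_of (i : ℤ × ℕ) (f : evComponent i) :
    obTotal (DirectSum.of (fun i => evComponent i) i f) =
      DirectSum.of (fun i => evComponent i) (i.1 + 1, i.2) (obComponent i f) := by
  rw [obTotal, ← DirectSum.lof_eq_of ℂ, ← DirectSum.lof_eq_of ℂ, DirectSum.toModule_lof,
    LinearMap.comp_apply]

/-- Degrees such as i + (j.1 + 1, j.2) and ((i + j).1 + 1, (i + j).2) agree only propositionally;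
this compares elements across such equalities. -/
lemma of_congr {i j : ℤ × ℕ} (h : i = j) {f : evComponent i} {g : evComponent j}
    (hfg : (f : ℍ × ℂ → ℂ) = g) :
    DirectSum.of (fun i => evComponent i) i f = DirectSum.of (fun i => evComponent i) j g := by
  subst h
  rw [Subtype.ext hfg]

lemma obTotal_mul (a b : EvWeakJacobi) : obTotal (a * b) = a • obTotal b + b • obTotal a := by
  induction a using DirectSum.induction_on with
  | zero => simp
  | add x y hx hy => rw [add_mul, map_add, hx, hy, map_add, add_smul, smul_add]; abel
  | of i f =>
    induction b using DirectSum.induction_on with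
    | zero => simp
    | add x y hx hy => rw [mul_add, map_add, hx, hy, map_add, add_smul, smul_add]; abel
    | of j g =>
      rw [DirectSum.of_mul_of, obTotal_of, obTotal_of, obTotal_of, smul_eq_mul, smul_eq_mul,
        DirectSum.of_mul_of, DirectSum.of_mul_of]
      have e1 : i + (j.1 + 1, j.2) = ((i + j).1 + 1, (i + j).2) := by
        ext <;> simp [add_assoc]
      have e2 : j + (i.1 + 1, i.2) = ((i + j).1 + 1, (i + j).2) := by
        ext
        · simp only [Prod.fst_add]
          ring
        · simp only [Prod.snd_add]
          ring
      have m1 : f * Ob (2 * j.1) j.2 g ∈ evComponent ((i + j).1 + 1, (i + j).2) :=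
        e1 ▸ SetLike.mul_mem_graded f.2 (Ob_mem_evComponent j g)
      have m2 : g * Ob (2 * i.1) i.2 f ∈ evComponent ((i + j).1 + 1, (i + j).2) :=
        e2 ▸ SetLike.mul_mem_graded g.2 (Ob_mem_evComponent i f)
      have key := Ob_mul (even_two_mul i.1) (even_two_mul j.1) f.2 g.2
      have e3 : obComponent (i + j) ⟨f * g, SetLike.mul_mem_graded f.2 g.2⟩ =
          ⟨f * Ob (2 * j.1) j.2 g, m1⟩ + ⟨g * Ob (2 * i.1) i.2 f, m2⟩ := by
        refine Subtype.ext ?_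
        change Ob (2 * (i.1 + j.1)) (i.2 + j.2) (f * g : ℍ × ℂ → ℂ) =
          f * Ob (2 * j.1) j.2 g + g * Ob (2 * i.1) i.2 f
        rw [mul_add, key, add_comm, mul_comm (Ob _ _ _)]
      have t1 := of_congr e1 (f := ⟨_, SetLike.mul_mem_graded f.2 (obComponent j g).2⟩)
        (g := ⟨f * Ob (2 * j.1) j.2 g, m1⟩) rfl
      have t2 := of_congr e2 (f := ⟨_, SetLike.mul_mem_graded g.2 (obComponent i f).2⟩)
        (g := ⟨g * Ob (2 * i.1) i.2 f, m2⟩) rfl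
      refine Eq.trans (congrArg _ e3) ?_
      exact (map_add _ _ _).trans (congrArg₂ (· + ·) t1.symm t2.symm)

/-- The derivation of the bigraded algebra of weak Jacobi forms given by `Ob`. -/
def obDerivation : Derivation ℂ EvWeakJacobi EvWeakJacobi where
  __ := obTotal
  map_one_eq_zero' := by
    -- Cancelling in D(1) = D(1) + D(1) needs negatives, which the scalar −1 supplies.
    let _ : AddCommGroup EvWeakJacobi := Module.addCommMonoidToAddCommGroup ℂ
    have := obTotal_mul 1 1
    rw [mul_one, one_smul] at this
    exact left_eq_add.mp this
  leibniz' := obTotal_mul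

lemma obDerivation_of (i : ℤ × ℕ) (f : evComponent i) :
    obDerivation (DirectSum.of (fun i => evComponent i) i f) =
      DirectSum.of (fun i => evComponent i) (i.1 + 1, i.2) (obComponent i f) :=
  obTotal_of i f

lemma extendsOb_obDerivation : ExtendsOb obDerivation := fun j p f =>
  ⟨Ob_mem_evComponent (j, p) f, obDerivation_of (j, p) f⟩

lemma ExtendsOb.unique {D D' : Derivation ℂ EvWeakJacobi EvWeakJacobi} (hD : ExtendsOb D)
    (hD' : ExtendsOb D') : D' = D := by
  refine Derivation.ext fun a => ?_
  induction a using DirectSum.induction_on with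
  | zero => simp
  | add x y hx hy => rw [map_add, map_add, hx, hy]
  | of i f =>
    obtain ⟨j, p⟩ := i
    obtain ⟨h, e⟩ := hD j p f
    obtain ⟨h', e'⟩ := hD' j p f
    rw [e, e']

/-! ### Modular forms -/

lemma isHolo_pull {f : ℍ → ℂ} (hf : DifferentiableOn ℂ (f ∘ ofComplex) upperHalfPlaneSet) :
    IsHolo (pull f) := fun x hx => by
  have := (hf.differentiableAt (isOpen_upperHalfPlaneSet.mem_nhds hx)).comp x differentiableAt_fst
  exact this.differentiableWithinAt

lemma slash_eq {j : ℤ} (f : ModularForm 𝒮ℒ j) (γ : SL(2, ℤ)) :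
    SlashAction.map j γ (f : ℍ → ℂ) = f :=
  SlashInvariantForm.slash_action_eqn f _ ⟨γ, rfl⟩

lemma pull_mem {j : ℤ} (f : ModularForm 𝒮ℒ j) : pull f ∈ weakJacobiForms j 0 := by
  refine ⟨isHolo_pull (UpperHalfPlane.mdifferentiable_iff.mp f.holo'), fun γ => ?_,
    fun a b => ?_, fun N => if N.2 = 0 then
      PowerSeries.coeff N.1 (qExpansion 1 f) else 0, fun N hN => ?_, fun x => ?_⟩
  · ext x
    have h := congrFun (slash_eq f γ) x.1
    rw [ModularForm.SL_slash_apply] at h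
    simp [slashSL, pull]
    rw [mul_comm]
    simpa using h
  · ext x
    simp [slashZ, pull]
  · have : N.2 = 0 := by
      by_contra h
      simp [h] at hN
    simp [this]
  · have h1 := ModularForm.hasSum_qExpansion f one_pos (by simp) x.1
    have hinj : Function.Injective fun n : ℕ => ((n, 0) : ℕ × ℤ) := fun m n h => by simpa using h
    rw [← hinj.hasSum_iff]
    · refine h1.congr_fun fun n => ?_
      simp [fourierMode, Function.Periodic.qParam, ← Complex.exp_nat_mul]
      left
      congr 1
      ring
    · rintro ⟨n, r⟩ hN
      have : r ≠ 0 := by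
        rintro rfl
        exact hN ⟨n, rfl⟩
      simp [this]

lemma Dz_pull (f : ℍ → ℂ) (x : ℍ × ℂ) : Dz (pull f) x = 0 := by
  simp [Dz, pull]

/-- In index 0 and without z-dependence the formula is constant in z, so the limit at lattice points
is immediate. -/
lemma Ob_pull {k : ℤ} {f : ℍ → ℂ} :
    Ob k 0 (pull f) = pull (Derivative.serreDerivative k f) := by
  have h : ∀ (τ : ℍ) (z : ℂ),
      obFormula k 0 (pull f) (τ, z) = pull (Derivative.serreDerivative k f) (τ, z) := by
    intro τ z
    simp only [obFormula, Dz_pull]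
    simp [pull, Dτ, Derivative.normalizedDerivOfComplex, Function.comp_def]
    exact Or.inl (Or.inl (div_eq_mul_inv _ _))
  ext ⟨τ, z⟩
  by_cases hz : z ∈ latt τ
  · have h0 : Ob k 0 (pull f) (τ, z) =
        limUnder (𝓝[≠] z) fun w : ℂ => obFormula k 0 (pull f) (τ, w) := if_pos hz
    rw [h0]
    simp only [h, pull]
    exact tendsto_const_nhds.limUnder_eq
  · rw [Ob_of_notMem hz, h]

/-- In index 0 the support condition reads r² ≤ 0, so the expansion at z = 0 is an ordinary
q-expansion with n ≥ 0. -/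
lemma isBoundedAtImInfty_of_pull {k : ℤ} {f : ℍ → ℂ} (hf : pull f ∈ weakJacobiForms k 0) :
    IsBoundedAtImInfty f := by
  obtain ⟨-, -, -, c, hc, hs⟩ := hf
  refine isBoundedAtImInfty_of_hasSum_qExpansion (c := fun n => c (n, 0)) one_pos fun τ => ?_
  have h1 := hs (τ, 0)
  have hinj : Function.Injective fun n : ℕ => ((n, 0) : ℕ × ℤ) := fun m n h => by simpa using h
  rw [← hinj.hasSum_iff] at h1
  · refine h1.congr_fun fun n => ?_
    simp [fourierMode, Function.Periodic.qParam, ← Complex.exp_nat_mul]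
    left
    congr 1
    ring
  · rintro ⟨n, r⟩ hN
    have hr : r ≠ 0 := by
      rintro rfl
      exact hN ⟨n, rfl⟩
    have : c (n, r) = 0 := by
      by_contra h
      have := hc _ h
      simp at this
      exact hr this
    simp [this]

/-- The Serre derivative of a modular form of level one. -/
def serreModularForm {k : ℤ} (hk : Even k) (f : ModularForm 𝒮ℒ k) : ModularForm 𝒮ℒ (k + 2) where
  toFun := Derivative.serreDerivative k f
  slash_action_eq' := by
    rintro _ ⟨γ, rfl⟩
    exact Derivative.serreDerivative_slash_invariant f.holo' (slash_eq f γ)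
  holo' := Derivative.serreDerivative_mdifferentiable k f.holo'
  bdd_at_cusps' := fun hc => by
    rw [OnePoint.isBoundedAt_iff_forall_SL2Z hc]
    intro γ _
    have h1 : SlashAction.map (k + 2) γ (Derivative.serreDerivative k f) =
        Derivative.serreDerivative k f :=
      Derivative.serreDerivative_slash_invariant f.holo' (slash_eq f γ)
    change IsBoundedAtImInfty (SlashAction.map (k + 2) γ (Derivative.serreDerivative k f))
    rw [h1]
    -- Boundedness at the cusp is read off from the Fourier expansion that `Ob_mem` provides.
    refine isBoundedAtImInfty_of_pull (k := k + 2) ?_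
    rw [← Ob_pull]
    exact Ob_mem hk (pull_mem f)

end

end WeakJacobi

open WeakJacobi in
theorem mainTheorem4 :
    (∀ (k : ℤ) (p : ℕ), Even k →
      ∃ T : weakJacobiForms k p →ₗ[ℂ] weakJacobiForms (k + 2) p,
        ∀ f : weakJacobiForms k p, (T f : ℍ × ℂ → ℂ) = Ob k p f) ∧
    (∀ (k l : ℤ) (p q : ℕ), Even k → Even l →
      ∀ f ∈ weakJacobiForms k p, ∀ g ∈ weakJacobiForms l q,
        Ob (k + l) (p + q) (f * g) = Ob k p f * g + f * Ob l q g) ∧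
    (∃ D : Derivation ℂ EvWeakJacobi EvWeakJacobi,
      ExtendsOb D ∧
      (∀ D' : Derivation ℂ EvWeakJacobi EvWeakJacobi, ExtendsOb D' → D' = D) ∧
      (∀ (j : ℤ) (f : ModularForm 𝒮ℒ (2 * j)),
        ∃ (h : pull f ∈ evComponent (j, 0)) (g : ModularForm 𝒮ℒ (2 * j + 2))
          (h' : pull g ∈ evComponent (j + 1, 0)),
          (g : ℍ → ℂ) = Derivative.serreDerivative ((2 * j : ℤ) : ℂ) f ∧
          D (DirectSum.of (fun i => evComponent i) (j, 0) ⟨pull f, h⟩) =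
            DirectSum.of (fun i => evComponent i) (j + 1, 0) ⟨pull g, h'⟩)) := by
  refine ⟨fun k p hk => ⟨obLinearMap p hk, fun f => rfl⟩,
    fun k l p q hk hl f hf g hg => Ob_mul hk hl hf hg,
    obDerivation, extendsOb_obDerivation, fun D' hD' => extendsOb_obDerivation.unique hD',
    fun j f => ⟨pull_mem f, serreModularForm (even_two_mul j) f, ?_, rfl, ?_⟩⟩
  · exact mem_of_weight_eq (mul_add_one 2 j).symm (pull_mem _)
  · rw [obDerivation_of]
    exact of_congr rfl Ob_pull
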